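/- **Model.** Let $n\ge 1$ and $[n]=\{1,\dots,n\}$. An algorithm (possibly randomized, with arbitrary internal randomness) plays against an adversary. In round $t=1,2,\dots$ the adversary chooses a monotone function $v_t:[n]\to[0,1]$, possibly depending on the algorithm's queries $q_1,\dots,q_{t-1}$ of the earlier rounds, and the algorithm, ignorant of $v_t$, chooses one query $q_t\in[n]$ and receives the answer $v_t(q_t)$. Producing a sample $x_t\in[n+1]$ is the special case $v_t(i)=\mathbf 1(x_t\le i)$. Let $F_T(i)=\frac1T\sum_{t=1}^T v_t(i)$; for samples this is the empirical CDF of $x_1,\dots,x_T$. After $T$ rounds the algorithm outputs an estimate $G_T:[n]\to[0,1]$ based on its internal randomness and the queries and answers so far. Write $\|G_T-F_T\|_\infty=\max_{i\in[n]}|G_T(i)-F_T(i)|$. The algorithm *solves the threshold query model with accuracy $\varepsilon$ and sample complexity $T$* if for every adaptive adversary and every $\tau\ge T$ one has $\Pr[\|G_\tau-F_\tau\|_\infty\le\varepsilon]\ge\frac34$. It *solves CDF estimation with accuracy $\varepsilon$ and sample complexity $T$* if this holds for every adaptive adversary that produces samples $x_t\in[n+1]$. It *solves CDF estimation from $T$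 i.i.d. samples with accuracy $\varepsilon$* if for every probability distribution $\mu$ on $[n+1]$, when $x_1,\dots,x_T$ are independent with law $\mu$ and independent of the algorithm's internal randomness, $\Pr[\|G_T-F_T\|_\infty\le\varepsilon]\ge\frac34$ at the single time $T$. **Theorem.** There is a universal constant $c>0$ such that for all integers $n>1$ and $T\ge1$, all real $0<\varepsilon<\frac12$ and every (possibly randomized) algorithm making one threshold query per sample: if the algorithm solves the threshold query model, or solves CDF estimation, with accuracy $\varepsilon$ and sample complexity $T$, then $$T\;\ge\; c\cdot\frac{\min\{n,\,1/\varepsilon\}\,\log n}{\varepsilon^2}.$$ The same lower bound holds if the algorithm only solves CDF estimation from $T$ i.i.d. samples with accuracy $\varepsilon$. -/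

import Mathlib

open MeasureTheory unitInterval

noncomputable section

namespace TQM

/-- The record of the queries made so far and the answers received, most recent round first.
The threshold `i + 1` of `[n] = {1, …, n}` is the element `i` of `Fin n`. -/
abbrev History (n : ℕ) : Type := List (Fin n × I)

/-- A randomized algorithm making one threshold query per sample. The internal randomness is a
seed `ω` drawn from a probability space `Ω`. The next query and the current estimate
`G : [n] → [0,1]` depend only on the seed and on the queries and answers so far. -/
structure Algorithm (n : ℕ) (Ω : Type*) [MeasurableSpace Ω] where
  query : Ω → History n → Fin n
  estimate : Ω → History n → Fin n → I
  measurable_query : ∀ h, Measurable fun ω => query ω h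
  measurable_estimate : ∀ h, Measurable fun ω => estimate ω h

/-- An adaptive adversary: the monotone function `v : [n] → [0,1]` of the next round, chosen as a
function of the queries of the earlier rounds (most recent first) and ignorant of the current
one. -/
abbrev Adversary (n : ℕ) : Type := List (Fin n) → (Fin n →o I)

/-- The function `i ↦ 1(x ≤ i)` on `[n]` for a sample `x ∈ [n + 1]`. The sample `j + 1` of
`[n + 1] = {1, …, n + 1}` is the element `j` of `Fin (n + 1)`. -/
def threshold {n : ℕ} (x : Fin (n + 1)) : Fin n →o I where
  toFun i := if (x : ℕ) ≤ (i : ℕ) then 1 else 0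
  monotone' := by
    intro i j hij
    have hij' : (i : ℕ) ≤ (j : ℕ) := hij
    dsimp only
    split_ifs with h₁ h₂
    · exact le_refl _
    · exact absurd (h₁.trans hij') h₂
    · exact unitInterval.nonneg _
    · exact le_refl _

variable {n : ℕ} {Ω : Type*} [MeasurableSpace Ω]

/-- The history of the first `t` rounds. -/
def history (A : Algorithm n Ω) (adv : Adversary n) (ω : Ω) : ℕ → History n
  | 0 => []
  | t + 1 =>
    (A.query ω (history A adv ω t),
      adv ((history A adv ω t).map Prod.fst) (A.query ω (history A adv ω t))) ::
        history A adv ω t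

/-- The function `v` that the adversary plays in the round with index `t` (counting from `0`). -/
def played (A : Algorithm n Ω) (adv : Adversary n) (ω : Ω) (t : ℕ) : Fin n →o I :=
  adv ((history A adv ω t).map Prod.fst)

/-- The average `F_T` of the functions played in the first `T` rounds; for functions
`threshold x₁, …, threshold x_T` it is the empirical CDF of `x₁, …, x_T`. -/
def empiricalCDF (A : Algorithm n Ω) (adv : Adversary n) (ω : Ω) (T : ℕ) (i : Fin n) : ℝ :=
  (1 / (T : ℝ)) * ∑ t ∈ Finset.range T, (played A adv ω t i : ℝ)

/-- The Kolmogorov–Smirnov error `‖G_T - F_T‖_∞` after `T` rounds (the norm of `Fin n → ℝ` is the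
sup norm). -/
def estimationError (A : Algorithm n Ω) (adv : Adversary n) (ω : Ω) (T : ℕ) : ℝ :=
  ‖fun i : Fin n => (A.estimate ω (history A adv ω T) i : ℝ) - empiricalCDF A adv ω T i‖

/-- `A` has accuracy `ε` and sample complexity `T` in the threshold query model: against every
adaptive adversary, at every time `τ ≥ T` the error is at most `ε` with probability at least
`3/4`. -/
def SolvesTQM (A : Algorithm n Ω) (P : Measure Ω) (ε : ℝ) (T : ℕ) : Prop :=
  ∀ adv : Adversary n, ∀ τ : ℕ, T ≤ τ → 3 / 4 ≤ P.real {ω | estimationError A adv ω τ ≤ ε}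

/-- `A` has accuracy `ε` and sample complexity `T` for CDF estimation: the same guarantee, required
only against adaptive adversaries that produce samples in `[n + 1]`. -/
def SolvesCDF (A : Algorithm n Ω) (P : Measure Ω) (ε : ℝ) (T : ℕ) : Prop :=
  ∀ X : List (Fin n) → Fin (n + 1), ∀ τ : ℕ, T ≤ τ →
    3 / 4 ≤ P.real {ω | estimationError A (fun qs => threshold (X qs)) ω τ ≤ ε}

/-- The adversary that plays the fixed samples `x 0, …, x (T - 1)` in the first `T` rounds (and
the value `1` of `[n + 1]` in the later rounds, which no statement about `T` rounds sees). -/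
def fixedSamples {T : ℕ} (x : Fin T → Fin (n + 1)) : Adversary n :=
  fun qs => threshold (if h : qs.length < T then x ⟨qs.length, h⟩ else 0)

/-- The guarantee for i.i.d. samples at the single time `T`: for every probability distribution `μ`
on `[n + 1]`, if `x₁, …, x_T` are independent with law `μ` and independent of the seed, then the
error at time `T`, with respect to the empirical CDF of the samples, is at most `ε` with
probability at least `3/4`. -/
def SolvesIID (A : Algorithm n Ω) (P : Measure Ω) (ε : ℝ) (T : ℕ) : Prop :=
  ∀ μ : Measure (Fin (n + 1)), IsProbabilityMeasure μ →
    3 / 4 ≤ (P.prod (Measure.pi fun _ : Fin T => μ)).real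
      {z | estimationError A (fixedSamples z.2) z.1 T ≤ ε}

end TQM

end

/-! Every model yields the same weaker guarantee `AccurateOnAverage`, since an adversary may play
samples fixed in advance. For a finite family of sample laws, averaging over the seed fixes a
deterministic algorithm that does well on average over the family (`AccurateOnAverage.exists_seed`).
Three families are used.

The main one (`AccurateOnAverage.block_bound`) has about k = min(n, 1/ε) blocks, up to constants,
with km about n. Each block hides an atom of mass p = 100ε at one of its m positions. An accurate
estimate reveals all positions θ, provided that every atom occurs often enough. Moving one atom
changes the law of an answer only for queries in its block, at a cost of order p² in relative
entropy per query. Under θ the decodings of the N = k(m-1) vectors that differ from θ in one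
coordinate are disjoint events, so their average probability is at most 1/N. Yet on average over θ
the correct decoding has probability at least 1/2. By the entropy inequality, raising an event from
1/N to 1/2 takes relative entropy of order log N, hence about (log N)/p² queries in a typical block.
The blocks share T queries, so T is at least of order k (log n)/ε².

Two simpler families supply the remaining ranges. Point masses give T of order log n when ε is
bounded below (`AccurateOnAverage.le_two_pow`). Three equally likely samples give T of order 1/ε²
(`AccurateOnAverage.one_le_sq_mul`): a threshold query cannot separate all three, and exchanging the
two it confuses moves the empirical CDF by a lazy random walk without changing the transcript. The
second bound settles bounded n and also ensures that all hidden atoms occur often enough. -/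

noncomputable section

namespace TQM

variable {n : ℕ}

/-! ### Means over independent samples -/

/-- The mean of `f (x_T, …, x_1)` for independent `x_t` with weights `w`. -/
def sampleMean {α : Type*} [Fintype α] (w : α → ℝ) : ℕ → (List α → ℝ) → ℝ
  | 0, f => f []
  | T + 1, f => sampleMean w T fun xs => ∑ y, w y * f (y :: xs)

section SampleMean

variable {α : Type*} [Fintype α] {w : α → ℝ}

theorem sampleMean_add (T : ℕ) (f g : List α → ℝ) :
    sampleMean w T (fun xs => f xs + g xs) = sampleMean w T f + sampleMean w T g := by
  induction T generalizing f g with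
  | zero => rfl
  | succ T ih =>
    simp only [sampleMean, mul_add, Finset.sum_add_distrib]
    exact ih _ _

theorem sampleMean_const_mul (T : ℕ) (c : ℝ) (f : List α → ℝ) :
    sampleMean w T (fun xs => c * f xs) = c * sampleMean w T f := by
  induction T generalizing f with
  | zero => rfl
  | succ T ih =>
    simp only [sampleMean]
    rw [← ih]
    simp only [Finset.mul_sum, mul_left_comm]

theorem sampleMean_sum {ι : Type*} (s : Finset ι) (T : ℕ) (f : ι → List α → ℝ) :
    sampleMean w T (fun xs => ∑ i ∈ s, f i xs) = ∑ i ∈ s, sampleMean w T (f i) := by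
  classical
  induction s using Finset.induction_on with
  | empty => simpa using sampleMean_const_mul (w := w) T 0 fun _ => 0
  | insert a s ha ih => simp only [Finset.sum_insert ha, sampleMean_add, ih]

theorem sampleMean_const (hw : ∑ y, w y = 1) (T : ℕ) (c : ℝ) :
    sampleMean w T (fun _ => c) = c := by
  induction T with
  | zero => rfl
  | succ T ih => simpa only [sampleMean, ← Finset.sum_mul, hw, one_mul] using ih

/-- Only lists of samples of positive weight matter. -/
theorem sampleMean_mono_of_support (hw : ∀ y, 0 ≤ w y) (T : ℕ) {f g : List α → ℝ}
    (h : ∀ xs, xs.length = T → (∀ y ∈ xs, w y ≠ 0) → f xs ≤ g xs) :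
    sampleMean w T f ≤ sampleMean w T g := by
  induction T generalizing f g with
  | zero => exact h [] rfl (by simp)
  | succ T ih =>
    refine ih fun xs hxs hs => Finset.sum_le_sum fun y _ => ?_
    rcases eq_or_ne (w y) 0 with hy | hy
    · rw [hy, zero_mul, zero_mul]
    · exact mul_le_mul_of_nonneg_left (h _ (by simp [hxs]) (by simpa [hy] using hs)) (hw y)

theorem sampleMean_mono (hw : ∀ y, 0 ≤ w y) (T : ℕ) {f g : List α → ℝ}
    (h : ∀ xs, f xs ≤ g xs) : sampleMean w T f ≤ sampleMean w T g :=
  sampleMean_mono_of_support hw T fun xs _ _ => h xs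

theorem sum_prod_weights_eq_sampleMean (T : ℕ) (f : List α → ℝ) :
    ∑ x : Fin T → α, (∏ t, w (x t)) * f (List.ofFn x).reverse = sampleMean w T f := by
  induction T generalizing f with
  | zero => simp [sampleMean]
  | succ T ih =>
    rw [sampleMean, ← ih, ← (Fin.snocEquiv fun _ => α).sum_comp, Fintype.sum_prod_type_right]
    refine Finset.sum_congr rfl fun x _ => ?_
    rw [Finset.mul_sum]
    refine Finset.sum_congr rfl fun y _ => ?_
    rw [Fin.prod_univ_castSucc, List.ofFn_succ']
    simp [Fin.snocEquiv, mul_assoc]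

end SampleMean

/-! ### Transcripts -/

/-- The history produced by the query rule `q` on a list of samples, most recent first. -/
def transcript (q : History n → Fin n) : List (Fin (n + 1)) → History n
  | [] => []
  | x :: xs => (q (transcript q xs), threshold x (q (transcript q xs))) :: transcript q xs

theorem length_transcript (q : History n → Fin n) (xs : List (Fin (n + 1))) :
    (transcript q xs).length = xs.length := by
  induction xs with
  | nil => rfl
  | cons x xs ih => simp [transcript, ih]

/-- The number of samples in `xs` that are at most the threshold `i`. -/
def thresholdSum (xs : List (Fin (n + 1))) (i : Fin n) : ℝ :=
  (xs.map fun x => (threshold x i : ℝ)).sum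

theorem thresholdSum_cons (x : Fin (n + 1)) (xs : List (Fin (n + 1))) (i : Fin n) :
    thresholdSum (x :: xs) i = (threshold x i : ℝ) + thresholdSum xs i := by
  simp [thresholdSum]

theorem threshold_val (x : Fin (n + 1)) (i : Fin n) :
    ((threshold x i : I) : ℝ) = if (x : ℕ) ≤ (i : ℕ) then 1 else 0 := by
  change (((if (x : ℕ) ≤ (i : ℕ) then 1 else 0 : I)) : ℝ) = _
  split_ifs <;> rfl

/-- The estimate `G` computed from the history is `ε`-accurate on the samples `xs`. -/
def Accurate (q : History n → Fin n) (G : History n → Fin n → I) (ε : ℝ) (T : ℕ)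
    (xs : List (Fin (n + 1))) : Prop :=
  ∀ i, |(G (transcript q xs) i : ℝ) - 1 / (T : ℝ) * thresholdSum xs i| ≤ ε

/-! ### Reduction of the three models to a deterministic algorithm facing independent samples. -/

section Algorithm

variable {Ω : Type*} [MeasurableSpace Ω]

theorem length_history (A : Algorithm n Ω) (adv : Adversary n) (ω : Ω) (t : ℕ) :
    (history A adv ω t).length = t := by
  induction t with
  | zero => rfl
  | succ t ih => simp [history, ih]

theorem played_fixedSamples (A : Algorithm n Ω) {T : ℕ} (x : Fin T → Fin (n + 1)) (ω : Ω)
    (t : Fin T) : played A (fixedSamples x) ω t = threshold (x t) := by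
  simp [played, fixedSamples, length_history]

theorem history_fixedSamples (A : Algorithm n Ω) {T : ℕ} (x : Fin T → Fin (n + 1)) (ω : Ω)
    (t : ℕ) (ht : t ≤ T) :
    history A (fixedSamples x) ω t =
      transcript (A.query ω) (List.ofFn fun i : Fin t => x (i.castLE ht)).reverse := by
  induction t with
  | zero => rfl
  | succ t ih =>
    have h := played_fixedSamples A x ω ⟨t, ht⟩
    simp only [played] at h
    rw [history, h, ih (Nat.le_of_succ_le ht), List.ofFn_succ', List.concat_eq_append,
      List.reverse_append]
    rfl

theorem estimationError_fixedSamples_le_iff (A : Algorithm n Ω) {T : ℕ} (hn : 0 < n)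
    (x : Fin T → Fin (n + 1)) (ω : Ω) (ε : ℝ) :
    estimationError A (fixedSamples x) ω T ≤ ε ↔
      Accurate (A.query ω) (A.estimate ω) ε T (List.ofFn x).reverse := by
  have : Nonempty (Fin n) := ⟨⟨0, hn⟩⟩
  have h1 := history_fixedSamples A x ω T le_rfl
  have h2 : ∀ i, empiricalCDF A (fixedSamples x) ω T i =
      1 / (T : ℝ) * thresholdSum (List.ofFn x).reverse i := by
    intro i
    rw [empiricalCDF, ← Fin.sum_univ_eq_sum_range
      (fun t => ((played A (fixedSamples x) ω t i : I) : ℝ)), thresholdSum, List.map_reverse,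
      List.sum_reverse, List.map_ofFn, List.sum_ofFn]
    simp only [played_fixedSamples, Function.comp]
  rw [estimationError, pi_norm_le_iff_of_nonempty]
  simp only [h1, h2, Accurate, Real.norm_eq_abs]
  rfl

theorem finite_range_history (A : Algorithm n Ω) (adv : Adversary n) (t : ℕ) :
    (Set.range fun ω => history A adv ω t).Finite := by
  induction t with
  | zero => exact (Set.finite_singleton ([] : History n)).subset (by rintro _ ⟨ω, rfl⟩; rfl)
  | succ t ih =>
    refine ((ih.prod (Set.finite_univ (α := Fin n))).image
      fun z => (z.2, adv (z.1.map Prod.fst) z.2) :: z.1).subset ?_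
    rintro _ ⟨ω, rfl⟩
    exact ⟨(history A adv ω t, A.query ω (history A adv ω t)), ⟨⟨ω, rfl⟩, trivial⟩, rfl⟩

theorem measurableSet_history_eq (A : Algorithm n Ω) (adv : Adversary n) (t : ℕ) (h : History n) :
    MeasurableSet {ω | history A adv ω t = h} := by
  induction t generalizing h with
  | zero => exact MeasurableSet.const (([] : History n) = h)
  | succ t ih =>
    cases h with
    | nil => simp [history]
    | cons z h =>
      have : {ω | history A adv ω (t + 1) = z :: h} =
          {ω | history A adv ω t = h} ∩
            ((fun ω => A.query ω h) ⁻¹' {z.1} ∩ {_ω | adv (h.map Prod.fst) z.1 = z.2}) := by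
        ext ω
        simp only [history, List.cons.injEq, Set.mem_ofPred_eq, Set.mem_inter_iff,
          Set.mem_preimage, Set.mem_singleton_iff]
        constructor
        · rintro ⟨rfl, rfl⟩
          exact ⟨rfl, rfl, rfl⟩
        · rintro ⟨rfl, h1, h2⟩
          refine ⟨?_, rfl⟩
          rw [h1, h2]
      rw [this]
      exact (ih h).inter ((A.measurable_query h (measurableSet_singleton _)).inter
        (MeasurableSet.const _))

/-- For fixed samples only finitely many histories can occur, so the event splits into finitely many
pieces on which the estimate is a measurable function of the seed. -/
theorem measurableSet_accurate (A : Algorithm n Ω) {T : ℕ} (hn : 0 < n)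
    (x : Fin T → Fin (n + 1)) (ε : ℝ) :
    MeasurableSet {ω | estimationError A (fixedSamples x) ω T ≤ ε} := by
  have : {ω | estimationError A (fixedSamples x) ω T ≤ ε} =
      ⋃ h ∈ Set.range fun ω => history A (fixedSamples x) ω T,
        {ω | history A (fixedSamples x) ω T = h} ∩
          {ω | ∀ i, |(A.estimate ω h i : ℝ) -
            1 / (T : ℝ) * thresholdSum (List.ofFn x).reverse i| ≤ ε} := by
    ext ω
    simp only [Set.mem_ofPred_eq, Set.mem_iUnion, Set.mem_inter_iff,
      estimationError_fixedSamples_le_iff A hn, Accurate]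
    rw [show transcript (A.query ω) (List.ofFn x).reverse = history A (fixedSamples x) ω T from
      (history_fixedSamples A x ω T le_rfl).symm]
    constructor
    · exact fun h => ⟨_, ⟨ω, rfl⟩, rfl, h⟩
    · rintro ⟨_, _, rfl, h⟩
      exact h
  rw [this]
  refine (finite_range_history A _ T).measurableSet_biUnion fun h _ =>
    (measurableSet_history_eq A _ T h).inter ?_
  rw [Set.ofPred_forall]
  refine MeasurableSet.iInter fun i => ?_
  have : Measurable fun ω => (A.estimate ω h i : ℝ) :=
    measurable_subtype_coe.comp ((measurable_pi_apply i).comp (A.measurable_estimate h))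
  exact measurableSet_le (by fun_prop) measurable_const

/-- On average over independent samples with weights `w`, the error is at most `ε` with
probability at least `3/4`. -/
def AccurateOnAverage (A : Algorithm n Ω) (P : Measure Ω) (ε : ℝ) (T : ℕ) : Prop :=
  ∀ w : Fin (n + 1) → ℝ, (∀ y, 0 ≤ w y) → ∑ y, w y = 1 →
    3 / 4 ≤ ∑ x : Fin T → Fin (n + 1),
      (∏ t, w (x t)) * P.real {ω | estimationError A (fixedSamples x) ω T ≤ ε}

theorem SolvesTQM.solvesCDF {A : Algorithm n Ω} {P : Measure Ω} {ε : ℝ} {T : ℕ}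
    (h : SolvesTQM A P ε T) : SolvesCDF A P ε T := fun _ τ hτ => h _ τ hτ

theorem SolvesCDF.accurateOnAverage {A : Algorithm n Ω} {P : Measure Ω} {ε : ℝ} {T : ℕ}
    (h : SolvesCDF A P ε T) : AccurateOnAverage A P ε T := by
  intro w hw hw1
  have h1 : ∑ x : Fin T → Fin (n + 1), ∏ t, w (x t) = 1 := by
    simpa [sampleMean_const hw1] using sum_prod_weights_eq_sampleMean (w := w) T fun _ => 1
  calc (3 / 4 : ℝ) = ∑ x : Fin T → Fin (n + 1), (∏ t, w (x t)) * (3 / 4) := by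
        rw [← Finset.sum_mul, h1, one_mul]
    _ ≤ _ := Finset.sum_le_sum fun x _ => mul_le_mul_of_nonneg_left
        (h (fun qs => if h : qs.length < T then x ⟨qs.length, h⟩ else 0) T le_rfl)
        (Finset.prod_nonneg fun t _ => hw _)

theorem SolvesIID.accurateOnAverage {A : Algorithm n Ω} {P : Measure Ω} [IsProbabilityMeasure P]
    {ε : ℝ} {T : ℕ} (h : SolvesIID A P ε T) : AccurateOnAverage A P ε T := by
  intro w hw hw1
  set μ : Measure (Fin (n + 1)) := ∑ y, ENNReal.ofReal (w y) • Measure.dirac y with hμ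
  have hμs : ∀ y, μ {y} = ENNReal.ofReal (w y) := by
    intro y
    simp [hμ, Measure.finsetSum_apply, Set.indicator_apply]
  have hμP : IsProbabilityMeasure μ := by
    constructor
    simp [hμ, Measure.finsetSum_apply, ← ENNReal.ofReal_sum_of_nonneg fun y _ => hw y, hw1]
  refine (h μ hμP).trans ?_
  -- Slicing by the finitely many sample vectors and using subadditivity makes joint measurability
  -- of the event unnecessary.
  have hsub : {z : Ω × (Fin T → Fin (n + 1)) | estimationError A (fixedSamples z.2) z.1 T ≤ ε} ⊆
      ⋃ x : Fin T → Fin (n + 1),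
        {ω | estimationError A (fixedSamples x) ω T ≤ ε} ×ˢ {x} := by
    rintro ⟨ω, x⟩ hz
    exact Set.mem_iUnion.2 ⟨x, hz, rfl⟩
  refine (measureReal_mono hsub).trans ((measureReal_iUnion_fintype_le _).trans ?_)
  refine Finset.sum_le_sum fun x _ => ?_
  rw [measureReal_prod_prod, mul_comm]
  refine le_of_eq ?_
  congr 1
  rw [measureReal_def, Measure.pi_singleton, ENNReal.toReal_prod]
  exact Finset.prod_congr rfl fun t _ => by rw [hμs, ENNReal.toReal_ofReal (hw _)]

open Classical in
/-- For a finite family of sample distributions some seed is accurate on average. -/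
theorem AccurateOnAverage.exists_seed {A : Algorithm n Ω} {P : Measure Ω}
    [IsProbabilityMeasure P] {ε : ℝ} {T : ℕ} (hn : 0 < n) (h : AccurateOnAverage A P ε T)
    {Θ : Type*} [Fintype Θ] (w : Θ → Fin (n + 1) → ℝ) (hw : ∀ θ y, 0 ≤ w θ y)
    (hw1 : ∀ θ, ∑ y, w θ y = 1) :
    ∃ ω, Fintype.card Θ * (3 / 4 : ℝ) ≤ ∑ θ, sampleMean (w θ) T fun xs =>
      if Accurate (A.query ω) (A.estimate ω) ε T xs then 1 else 0 := by
  set S : (Fin T → Fin (n + 1)) → Set Ω :=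
    fun x => {ω | estimationError A (fixedSamples x) ω T ≤ ε} with hS
  have hSm : ∀ x, MeasurableSet (S x) := fun x => measurableSet_accurate A hn x ε
  set f : Ω → ℝ := fun ω => ∑ θ, ∑ x : Fin T → Fin (n + 1),
    (∏ t, w θ (x t)) * (S x).indicator 1 ω with hf
  have hi : ∀ x, Integrable ((S x).indicator (1 : Ω → ℝ)) P := fun x =>
    (integrable_const (1 : ℝ)).indicator (hSm x)
  have hfi : Integrable f P :=
    integrable_finsetSum _ fun θ _ => integrable_finsetSum _ fun x _ => (hi x).const_mul _
  have hfint : ∫ ω, f ω ∂P =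
      ∑ θ, ∑ x : Fin T → Fin (n + 1), (∏ t, w θ (x t)) * P.real (S x) := by
    rw [hf, integral_finsetSum _ fun θ _ => integrable_finsetSum _ fun x _ => (hi x).const_mul _]
    refine Finset.sum_congr rfl fun θ _ => ?_
    rw [integral_finsetSum _ fun x _ => (hi x).const_mul _]
    refine Finset.sum_congr rfl fun x _ => ?_
    rw [integral_const_mul, integral_indicator_one (hSm x)]
  obtain ⟨ω, hω⟩ := exists_integral_le hfi
  refine ⟨ω, ?_⟩
  have h1 : Fintype.card Θ * (3 / 4 : ℝ) ≤ f ω := by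
    refine le_trans ?_ (hfint ▸ hω)
    simpa using Finset.sum_le_sum fun θ (_ : θ ∈ Finset.univ) => h (w θ) (hw θ) (hw1 θ)
  refine h1.trans (le_of_eq ?_)
  refine Finset.sum_congr rfl fun θ _ => ?_
  rw [← sum_prod_weights_eq_sampleMean]
  refine Finset.sum_congr rfl fun x _ => ?_
  simp only [hS, Set.indicator_apply, Set.mem_ofPred_eq, estimationError_fixedSamples_le_iff A hn,
    Pi.one_apply]

end Algorithm

/-! ### Point masses: a bound of order `log n` -/

theorem sampleMean_single {α : Type*} [Fintype α] [DecidableEq α] (a : α) (T : ℕ)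
    (f : List α → ℝ) : sampleMean (Pi.single a 1) T f = f (List.replicate T a) := by
  induction T generalizing f with
  | zero => rfl
  | succ T ih =>
    rw [sampleMean, ih, List.replicate_succ]
    simp [Pi.single_apply]

open Classical in
-- The query is a function of the history and its answer is one bit, so each round at most doubles
-- the number of transcripts.
theorem card_transcript_replicate_le (q : History n → Fin n) (T : ℕ) :
    (Finset.univ.image fun a : Fin (n + 1) => transcript q (List.replicate T a)).card ≤
      2 ^ T := by
  induction T with
  | zero =>
    refine Finset.card_le_one.2 fun x hx y hy => ?_
    simp only [Finset.mem_image, List.replicate_zero, transcript] at hx hy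
    obtain ⟨_, _, rfl⟩ := hx
    obtain ⟨_, _, rfl⟩ := hy
    rfl
  | succ T ih =>
    set s := Finset.univ.image fun a : Fin (n + 1) => transcript q (List.replicate T a) with hs
    have hsub : (Finset.univ.image fun a : Fin (n + 1) =>
        transcript q (List.replicate (T + 1) a)) ⊆
        (s ×ˢ ({0, 1} : Finset I)).image fun z => (q z.1, z.2) :: z.1 := by
      intro x hx
      obtain ⟨a, -, rfl⟩ := Finset.mem_image.1 hx
      refine Finset.mem_image.2 ⟨(transcript q (List.replicate T a),
        threshold a (q (transcript q (List.replicate T a)))), Finset.mem_product.2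
        ⟨Finset.mem_image_of_mem _ (Finset.mem_univ a), ?_⟩, rfl⟩
      change (if _ then (1 : I) else 0) ∈ _
      split_ifs <;> simp
    refine (Finset.card_le_card hsub).trans (Finset.card_image_le.trans ?_)
    rw [Finset.card_product, pow_succ]
    exact Nat.mul_le_mul ih Finset.card_le_two

theorem thresholdSum_replicate (T : ℕ) (a : Fin (n + 1)) (i : Fin n) :
    thresholdSum (List.replicate T a) i = T * (threshold a i : ℝ) := by
  simp [thresholdSum]

theorem threshold_injective : Function.Injective (threshold : Fin (n + 1) → Fin n →o I) := by
  have key : ∀ a b : Fin (n + 1), threshold a = threshold b → (a : ℕ) ≤ b := by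
    intro a b h
    by_contra! hlt
    have hb : (b : ℕ) < n := by omega
    have h1 : ((threshold a ⟨b, hb⟩ : I) : ℝ) = (threshold b ⟨b, hb⟩ : I) := by rw [h]
    rw [threshold_val, threshold_val] at h1
    simp at h1
    omega
  exact fun a b h => Fin.ext (le_antisymm (key a b h) (key b a h.symm))

/-- On a constant sample an accurate estimate determines the sample. -/
theorem eq_of_accurate_replicate {q : History n → Fin n} {G : History n → Fin n → I} {ε : ℝ}
    {T : ℕ} (hT : 0 < T) (hε : ε < 1 / 2) {a b : Fin (n + 1)}
    (ha : Accurate q G ε T (List.replicate T a)) (hb : Accurate q G ε T (List.replicate T b))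
    (hab : transcript q (List.replicate T a) = transcript q (List.replicate T b)) : a = b := by
  refine threshold_injective (OrderHom.ext _ _ (funext fun i => ?_))
  have h1 := ha i
  have h2 := hb i
  have hT' : (T : ℝ) ≠ 0 := by positivity
  rw [thresholdSum_replicate, ← mul_assoc, one_div_mul_cancel hT', one_mul, abs_le] at h1 h2
  rw [hab] at h1
  apply Subtype.ext
  rw [threshold_val] at h1 h2 ⊢
  rw [threshold_val]
  split_ifs at h1 h2 ⊢ <;> linarith

section

variable {Ω : Type*} [MeasurableSpace Ω] {A : Algorithm n Ω} {P : Measure Ω}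
  [IsProbabilityMeasure P] {ε : ℝ} {T : ℕ}

open Classical in
-- The constant samples on which the fixed seed succeeds have distinct transcripts.
theorem AccurateOnAverage.le_two_pow (h : AccurateOnAverage A P ε T) (hn : 0 < n) (hT : 0 < T)
    (hε : ε < 1 / 2) : ((n : ℝ) + 1) * (3 / 4) ≤ 2 ^ T := by
  obtain ⟨ω, hω⟩ := h.exists_seed hn (fun a : Fin (n + 1) => Pi.single a 1)
    (fun a y => by
      rw [Pi.single_apply]
      positivity)
    (fun a => by simp)
  simp only [sampleMean_single, Finset.sum_boole, Fintype.card_fin] at hω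
  refine (by exact_mod_cast hω : ((n : ℝ) + 1) * (3 / 4) ≤ _).trans ?_
  have hcard := card_transcript_replicate_le (A.query ω) T
  have := Finset.card_le_card_of_injOn
    (s := Finset.univ.filter fun a => Accurate (A.query ω) (A.estimate ω) ε T
      (List.replicate T a))
    (t := Finset.univ.image fun a : Fin (n + 1) => transcript (A.query ω) (List.replicate T a))
    (fun a => transcript (A.query ω) (List.replicate T a))
    (fun a _ => Finset.mem_coe.2 (Finset.mem_image_of_mem _ (Finset.mem_univ a)))
    (fun a ha b hb hab => eq_of_accurate_replicate hT hε (Finset.mem_filter.1 ha).2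
      (Finset.mem_filter.1 hb).2 hab)
  exact_mod_cast this.trans hcard

end

/-! ### The lazy random walk -/

/-- The mean of `f (R_T)` for a walk `R` on `ℤ` with independent uniform steps in `{-1, 0, 1}`. -/
def walkMean : ℕ → (ℤ → ℝ) → ℝ
  | 0, f => f 0
  | T + 1, f => walkMean T fun r => (f (r - 1) + f r + f (r + 1)) / 3

theorem walkMean_mono (T : ℕ) {f g : ℤ → ℝ} (h : ∀ r, f r ≤ g r) :
    walkMean T f ≤ walkMean T g := by
  induction T generalizing f g with
  | zero => exact h 0
  | succ T ih => exact ih fun r => by linarith [h (r - 1), h r, h (r + 1)]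

theorem walkMean_add (T : ℕ) (f g : ℤ → ℝ) :
    walkMean T (fun r => f r + g r) = walkMean T f + walkMean T g := by
  induction T generalizing f g with
  | zero => rfl
  | succ T ih =>
    simp only [walkMean]
    rw [← ih]
    congr 1
    funext r
    ring

theorem walkMean_const_mul (T : ℕ) (c : ℝ) (f : ℤ → ℝ) :
    walkMean T (fun r => c * f r) = c * walkMean T f := by
  induction T generalizing f with
  | zero => rfl
  | succ T ih =>
    simp only [walkMean]
    rw [← ih]
    congr 1
    funext r
    ring

theorem walkMean_const (T : ℕ) (c : ℝ) : walkMean T (fun _ => c) = c := by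
  induction T with
  | zero => rfl
  | succ T ih =>
    simp only [walkMean]
    rw [show (c + c + c) / 3 = c by ring, ih]

theorem walkMean_sum {ι : Type*} (s : Finset ι) (T : ℕ) (f : ι → ℤ → ℝ) :
    walkMean T (fun r => ∑ i ∈ s, f i r) = ∑ i ∈ s, walkMean T (f i) := by
  classical
  induction s using Finset.induction_on with
  | empty => simpa using walkMean_const T 0
  | insert a s ha ih => simp only [Finset.sum_insert ha, walkMean_add, ih]

/-- The probability that the walk is at `a` at time `T`. -/
def walkProb (T : ℕ) (a : ℤ) : ℝ := walkMean T fun r => if r = a then 1 else 0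

theorem walkProb_succ (T : ℕ) (a : ℤ) :
    walkProb (T + 1) a = (walkProb T (a - 1) + walkProb T a + walkProb T (a + 1)) / 3 := by
  have h : ∀ r : ℤ, ((if r - 1 = a then (1 : ℝ) else 0) + (if r = a then 1 else 0) +
      (if r + 1 = a then 1 else 0)) / 3 =
      1 / 3 * ((if r = a - 1 then 1 else 0) + (if r = a then 1 else 0) +
        if r = a + 1 then 1 else 0) := by
    intro r
    simp only [show r - 1 = a ↔ r = a + 1 by omega, show r + 1 = a ↔ r = a - 1 by omega]
    ring
  simp only [walkProb, walkMean, h, walkMean_const_mul, walkMean_add]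
  ring

theorem walkProb_nonneg (T : ℕ) (a : ℤ) : 0 ≤ walkProb T a :=
  (walkMean_const T 0).symm.le.trans (walkMean_mono T fun r => by positivity)

theorem walkProb_neg (T : ℕ) (a : ℤ) : walkProb T (-a) = walkProb T a := by
  induction T generalizing a with
  | zero => simp [walkProb, walkMean, eq_comm]
  | succ T ih =>
    rw [walkProb_succ, walkProb_succ, show -a - 1 = -(a + 1) by ring,
      show -a + 1 = -(a - 1) by ring, ih, ih, ih]
    ring

/-- The law of the walk is symmetric and unimodal. -/
theorem walkProb_anti (T : ℕ) {a b : ℤ} (h : |a| ≤ |b|) : walkProb T b ≤ walkProb T a := by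
  induction T generalizing a b with
  | zero =>
    simp only [walkProb, walkMean]
    split_ifs with h1 h2
    · exact le_rfl
    · subst h1
      exact absurd (abs_nonpos_iff.1 (by simpa using h)).symm h2
    · exact zero_le_one
    · exact le_rfl
  | succ T ih =>
    have habs : ∀ c : ℤ, walkProb (T + 1) |c| = walkProb (T + 1) c := by
      intro c
      rcases abs_choice c with hc | hc <;> rw [hc]
      exact walkProb_neg _ _
    have step : ∀ m : ℕ, walkProb (T + 1) ((m + 1 : ℕ) : ℤ) ≤ walkProb (T + 1) (m : ℤ) := by
      intro m
      rw [walkProb_succ, walkProb_succ]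
      -- In the difference of the two three-term averages only the outer terms, at m + 2 and m - 1,
      -- survive.
      have : walkProb T (((m + 1 : ℕ) : ℤ) + 1) ≤ walkProb T ((m : ℤ) - 1) := ih (by
        rw [abs_le]
        push_cast
        rw [abs_of_nonneg (by positivity : (0 : ℤ) ≤ (m : ℤ) + 1 + 1)]
        omega)
      push_cast at this ⊢
      rw [show (m : ℤ) + 1 - 1 = m by ring]
      linarith
    have hanti : Antitone fun m : ℕ => walkProb (T + 1) (m : ℤ) := antitone_nat_of_succ_le step
    rw [← habs a, ← habs b]
    have := hanti (show a.natAbs ≤ b.natAbs by zify; exact h)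
    simpa only [Int.natCast_natAbs] using this

theorem walkProb_le_third {T : ℕ} (hT : 0 < T) : walkProb T 0 ≤ 1 / 3 := by
  obtain ⟨T, rfl⟩ := Nat.exists_eq_succ_of_ne_zero hT.ne'
  have h : walkProb T (0 - 1) + walkProb T 0 + walkProb T (0 + 1) ≤ 1 := by
    simp only [walkProb]
    rw [← walkMean_add, ← walkMean_add]
    refine (walkMean_mono T fun r => ?_).trans (walkMean_const T 1).le
    split_ifs <;> first | omega | norm_num
  rw [walkProb_succ]
  simp only [zero_sub, zero_add] at h ⊢
  linarith

theorem walkProb_zero_antitone : Antitone fun T => walkProb T 0 := by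
  refine antitone_nat_of_succ_le fun T => ?_
  have h1 := walkProb_anti T (a := 0) (b := 0 - 1) (by simp)
  have h2 := walkProb_anti T (a := 0) (b := 0 + 1) (by simp)
  rw [walkProb_succ]
  simp only [zero_sub, zero_add] at h1 h2 ⊢
  linarith

theorem walkMean_sq (T : ℕ) : walkMean T (fun r => (r : ℝ) ^ 2) = 2 / 3 * T := by
  induction T with
  | zero => simp [walkMean]
  | succ T ih =>
    have h : ∀ r : ℤ, ((((r - 1 : ℤ) : ℝ)) ^ 2 + (r : ℝ) ^ 2 + (((r + 1 : ℤ) : ℝ)) ^ 2) / 3 =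
        (r : ℝ) ^ 2 + 2 / 3 := by
      intro r
      push_cast
      ring
    simp only [walkMean, h, walkMean_add, ih, walkMean_const]
    push_cast
    ring

/-- The mean of `|R_T|` counts the visits to `0`. -/
theorem walkMean_abs (T : ℕ) :
    walkMean T (fun r => |(r : ℝ)|) = 2 / 3 * ∑ t ∈ Finset.range T, walkProb t 0 := by
  induction T with
  | zero => simp [walkMean]
  | succ T ih =>
    -- The absolute value is harmonic for the walk except at 0, where a step raises its mean by 2/3.
    have h : ∀ r : ℤ, (|((r - 1 : ℤ) : ℝ)| + |(r : ℝ)| + |((r + 1 : ℤ) : ℝ)|) / 3 =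
        |(r : ℝ)| + 2 / 3 * if r = 0 then 1 else 0 := by
      intro r
      split_ifs with h0
      · subst h0
        norm_num
      · rcases lt_or_gt_of_ne h0 with hr | hr
        · have h1 : (r : ℝ) + 1 ≤ 0 := by exact_mod_cast hr
          push_cast
          rw [abs_of_nonpos, abs_of_nonpos, abs_of_nonpos] <;> linarith
        · have h1 : (1 : ℝ) ≤ r := by exact_mod_cast hr
          push_cast
          rw [abs_of_nonneg, abs_of_nonneg, abs_of_nonneg] <;> linarith
    simp only [walkMean, h, walkMean_add, ih, walkMean_const_mul]
    rw [Finset.sum_range_succ, mul_add, walkProb]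

/-- The return probabilities decrease in time, so T times the last one is at most their sum, which
is 3/2 of the mean of |R_T|. The second moment 2T/3 bounds that mean. -/
theorem sq_walkProb_zero_mul_le {T : ℕ} (hT : 0 < T) : walkProb T 0 * √T ≤ 5 / 4 := by
  have hs : 0 < √(T : ℝ) := Real.sqrt_pos.2 (by positivity)
  have hss : √(T : ℝ) * √T = T := Real.mul_self_sqrt (by positivity)
  have h1 : (T : ℝ) * walkProb T 0 ≤ 3 / 2 * walkMean T fun r => |(r : ℝ)| := by
    rw [walkMean_abs, ← mul_assoc]
    have := Finset.card_nsmul_le_sum (Finset.range T) (fun t => walkProb t 0) (walkProb T 0)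
      fun t ht => walkProb_zero_antitone (Finset.mem_range.1 ht).le
    rw [Finset.card_range, nsmul_eq_mul] at this
    linarith
  have h2 : (walkMean T fun r => |(r : ℝ)|) ≤
      5 / 8 * (1 / √T) * (2 / 3 * T) + 2 / 5 * √T := by
    rw [← walkMean_sq, ← walkMean_const_mul, ← walkMean_const T (2 / 5 * √T), ← walkMean_add]
    refine walkMean_mono T fun r => ?_
    -- The tangent point 4/5 · √T is close to the optimal √(2/3) · √T; the resulting bound 49/60 ·
    -- √T on the mean gives 49/40 ≤ 5/4.
    have h3 := sq_nonneg (|(r : ℝ)| - 4 / 5 * √T)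
    rw [← sq_abs (r : ℝ)]
    rw [show 5 / 8 * (1 / √(T : ℝ)) * |(r : ℝ)| ^ 2 + 2 / 5 * √T =
      (5 / 8 * |(r : ℝ)| ^ 2 + 2 / 5 * (√T * √T)) / √T by field_simp]
    rw [le_div_iff₀ hs]
    nlinarith
  rw [show 5 / 8 * (1 / √(T : ℝ)) * (2 / 3 * T) = 5 / 12 * √T by
    field_simp
    rw [sq, hss]
    ring] at h2
  have h3 : √T * (walkProb T 0 * √T) ≤ √T * (5 / 4) := by
    rw [mul_left_comm, hss]
    linarith
  exact le_of_mul_le_mul_left h3 hs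

theorem walkMean_abs_le_le (T : ℕ) (b : ℝ) :
    walkMean T (fun r => if |(r : ℝ)| ≤ b then 1 else 0) ≤ (2 * ⌊b⌋₊ + 1) * walkProb T 0 := by
  have h1 : ∀ r : ℤ, (if |(r : ℝ)| ≤ b then (1 : ℝ) else 0) ≤
      ∑ a ∈ Finset.Icc (-(⌊b⌋₊ : ℤ)) ⌊b⌋₊, if r = a then 1 else 0 := by
    intro r
    rw [Finset.sum_ite_eq]
    split_ifs with h2 h3
    · exact le_rfl
    · refine absurd ?_ h3
      have : r.natAbs ≤ ⌊b⌋₊ := Nat.le_floor (by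
        rw [Nat.cast_natAbs]
        exact_mod_cast h2)
      rw [Finset.mem_Icc]
      omega
    · exact zero_le_one
    · exact le_rfl
  refine (walkMean_mono T h1).trans ?_
  rw [walkMean_sum]
  refine (Finset.sum_le_card_nsmul _ _ (walkProb T 0) fun a _ => ?_).trans (le_of_eq ?_)
  · exact walkProb_anti T (by simp)
  · rw [Int.card_Icc, nsmul_eq_mul,
      show ((⌊b⌋₊ : ℤ) + 1 - -(⌊b⌋₊ : ℤ)).toNat = 2 * ⌊b⌋₊ + 1 by omega]
    push_cast
    ring

/-- For b < 1 only the origin counts. Otherwise at most 3b sites count, each of probability at most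
5/(4√T), and 3 · (2/15) · (5/4) = 1/2. -/
theorem walkMean_abs_le_lt_half {T : ℕ} (hT : 0 < T) {b : ℝ} (hb : 0 ≤ b)
    (hbT : b < 2 / 15 * √T) :
    walkMean T (fun r => if |(r : ℝ)| ≤ b then 1 else 0) < 1 / 2 := by
  have h := walkMean_abs_le_le T b
  have h0 := walkProb_nonneg T 0
  rcases lt_or_ge b 1 with h1 | h1
  · rw [Nat.floor_eq_zero.2 h1] at h
    have := walkProb_le_third hT
    norm_num at h
    linarith
  · have h2 := Nat.floor_le hb
    have h3 := sq_walkProb_zero_mul_le hT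
    have hs : 0 < √(T : ℝ) := Real.sqrt_pos.2 (by positivity)
    have h4 : (2 * (⌊b⌋₊ : ℝ) + 1) * walkProb T 0 ≤ 3 * b * walkProb T 0 :=
      mul_le_mul_of_nonneg_right (by linarith) h0
    rcases h0.eq_or_lt with h5 | h5
    · rw [← h5] at h
      linarith
    · nlinarith

/-! ### Three equally likely samples: a bound of order `1 / ε ^ 2` -/

/-- The uniform weights on the three smallest samples. -/
def triWeight (n : ℕ) (y : Fin (n + 1)) : ℝ := if (y : ℕ) ≤ 2 then 1 / 3 else 0

theorem triWeight_nonneg (y : Fin (n + 1)) : 0 ≤ triWeight n y := by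
  rw [triWeight]
  positivity

/-- The `k`-th of the three smallest samples. -/
def smallSample (hn : 2 ≤ n) (k : Fin 3) : Fin (n + 1) := k.castLE (by omega)

theorem smallSample_val (hn : 2 ≤ n) (k : Fin 3) : (smallSample hn k : ℕ) = k := rfl

theorem sum_triWeight_mul (hn : 2 ≤ n) (f : Fin (n + 1) → ℝ) :
    ∑ y, triWeight n y * f y =
      (f (smallSample hn 0) + f (smallSample hn 1) + f (smallSample hn 2)) / 3 := by
  obtain ⟨m, rfl⟩ := Nat.exists_eq_add_of_le' hn
  have h : ∀ y : Fin m, ¬ (y : ℕ) + 1 + 1 + 1 ≤ 2 := fun y => by omega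
  rw [Fin.sum_univ_succ, Fin.sum_univ_succ, Fin.sum_univ_succ]
  simp only [triWeight, Fin.val_succ, h, if_false, zero_mul, Finset.sum_const_zero]
  simp only [Fin.val_zero, zero_add, Nat.zero_le, Nat.one_le_ofNat, Nat.reduceAdd, le_refl, if_true]
  change 1 / 3 * f (smallSample hn 0) + (1 / 3 * f (smallSample hn 1) +
    (1 / 3 * f (smallSample hn 2) + 0)) = _
  ring

theorem sum_triWeight (hn : 2 ≤ n) : ∑ y, triWeight n y = 1 := by
  have := sum_triWeight_mul hn fun _ => 1
  norm_num at this
  exact this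

/-- Exchanges two of the three smallest samples that the threshold `i` does not separate. -/
def flipPerm (hn : 2 ≤ n) (i : Fin n) : Equiv.Perm (Fin (n + 1)) :=
  if (i : ℕ) = 0 then Equiv.swap (smallSample hn 1) (smallSample hn 2)
  else Equiv.swap (smallSample hn 0) (smallSample hn 1)

theorem flipPerm_val (hn : 2 ≤ n) (i : Fin n) (y : Fin (n + 1)) :
    (flipPerm hn i y : ℕ) =
      if (i : ℕ) = 0 then if (y : ℕ) = 1 then 2 else if (y : ℕ) = 2 then 1 else (y : ℕ)
      else if (y : ℕ) = 0 then 1 else if (y : ℕ) = 1 then 0 else (y : ℕ) := by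
  rw [flipPerm]
  by_cases hi : (i : ℕ) = 0
  · rw [if_pos hi, if_pos hi, Equiv.swap_apply_def]
    simp only [apply_ite Fin.val, Fin.ext_iff, smallSample_val]
    rfl
  · rw [if_neg hi, if_neg hi, Equiv.swap_apply_def]
    simp only [apply_ite Fin.val, Fin.ext_iff, smallSample_val]
    rfl

theorem threshold_flipPerm (hn : 2 ≤ n) (i : Fin n) (y : Fin (n + 1)) :
    threshold (flipPerm hn i y) i = threshold y i := by
  apply Subtype.ext
  rw [threshold_val, threshold_val, flipPerm_val]
  congr 1
  apply propext
  split_ifs <;> omega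

theorem triWeight_flipPerm (hn : 2 ≤ n) (i : Fin n) (y : Fin (n + 1)) :
    triWeight n (flipPerm hn i y) = triWeight n y := by
  rw [triWeight, triWeight, flipPerm_val]
  congr 1
  apply propext
  split_ifs <;> omega

/-- Applies to every sample the exchange that its query does not notice. -/
def flipSamples (hn : 2 ≤ n) (q : History n → Fin n) : List (Fin (n + 1)) → List (Fin (n + 1))
  | [] => []
  | x :: xs => flipPerm hn (q (transcript q xs)) x :: flipSamples hn q xs

theorem transcript_flipSamples (hn : 2 ≤ n) (q : History n → Fin n) (xs : List (Fin (n + 1))) :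
    transcript q (flipSamples hn q xs) = transcript q xs := by
  induction xs with
  | nil => rfl
  | cons x xs ih => simp only [flipSamples, transcript, ih, threshold_flipPerm]

/-- Given the earlier samples, the exchange is a fixed permutation that preserves the weights. -/
theorem sampleMean_flipSamples (hn : 2 ≤ n) (q : History n → Fin n) (T : ℕ)
    (f : List (Fin (n + 1)) → ℝ) :
    sampleMean (triWeight n) T (fun xs => f (flipSamples hn q xs)) =
      sampleMean (triWeight n) T f := by
  induction T generalizing f with
  | zero => rfl
  | succ T ih =>
    simp only [sampleMean, flipSamples]
    rw [← ih fun xs => ∑ y, triWeight n y * f (y :: xs)]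
    congr 1
    funext xs
    rw [← Equiv.sum_comp (flipPerm hn (q (transcript q xs)))
      fun y => triWeight n y * f (y :: flipSamples hn q xs)]
    simp only [triWeight_flipPerm]

/-- The number of the two smallest thresholds that are at least `y`. -/
def level (y : Fin (n + 1)) : ℤ := (2 - (y : ℕ) : ℕ)

/-- The change of the total level under `flipSamples`. -/
def flipDiff (hn : 2 ≤ n) (q : History n → Fin n) (xs : List (Fin (n + 1))) : ℤ :=
  ((flipSamples hn q xs).map level).sum - (xs.map level).sum

theorem flipDiff_cons (hn : 2 ≤ n) (q : History n → Fin n) (x : Fin (n + 1))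
    (xs : List (Fin (n + 1))) :
    flipDiff hn q (x :: xs) =
      flipDiff hn q xs + (level (flipPerm hn (q (transcript q xs)) x) - level x) := by
  simp only [flipDiff, flipSamples, List.map_cons, List.sum_cons]
  ring

theorem sum_level (hn : 2 ≤ n) (xs : List (Fin (n + 1))) :
    (((xs.map level).sum : ℤ) : ℝ) =
      thresholdSum xs ⟨0, by omega⟩ + thresholdSum xs ⟨1, by omega⟩ := by
  induction xs with
  | nil => simp [thresholdSum]
  | cons x xs ih =>
    rw [List.map_cons, List.sum_cons, thresholdSum_cons, thresholdSum_cons, threshold_val,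
      threshold_val]
    rw [Int.cast_add, ih]
    have : ((level x : ℤ) : ℝ) =
        (if (x : ℕ) ≤ 0 then 1 else 0) + if (x : ℕ) ≤ 1 then 1 else 0 := by
      rcases (by omega : (x : ℕ) = 0 ∨ (x : ℕ) = 1 ∨ 2 ≤ (x : ℕ)) with h | h | h
      · rw [level, h]
        norm_num
      · rw [level, h]
        norm_num
      · rw [level, Nat.sub_eq_zero_of_le h, if_neg (by omega), if_neg (by omega)]
        norm_num
    rw [this]
    ring

/-- Whichever exchange is made, it joins adjacent levels: the three equally likely samples change
the level by 1, -1 and 0. -/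
theorem sampleMean_flipDiff (hn : 2 ≤ n) (q : History n → Fin n) (T : ℕ) (g : ℤ → ℝ) :
    sampleMean (triWeight n) T (fun xs => g (flipDiff hn q xs)) = walkMean T g := by
  induction T generalizing g with
  | zero => rfl
  | succ T ih =>
    simp only [sampleMean, walkMean, flipDiff_cons]
    rw [← ih]
    congr 1
    funext xs
    rw [sum_triWeight_mul hn]
    by_cases hi : (q (transcript q xs) : ℕ) = 0
    · simp only [level, flipPerm_val, smallSample_val, hi, if_true]
      norm_num [sub_eq_add_neg]
      ring
    · simp only [level, flipPerm_val, smallSample_val, hi, if_false]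
      norm_num [sub_eq_add_neg]
      ring

open Classical in
theorem sampleMean_accurate_le (hn : 2 ≤ n) (q : History n → Fin n)
    (G : History n → Fin n → I) (ε : ℝ) {T : ℕ} (hT : 0 < T) :
    sampleMean (triWeight n) T (fun xs => if Accurate q G ε T xs then 1 else 0) ≤
      1 / 2 + 1 / 2 * walkMean T fun r => if |(r : ℝ)| ≤ 4 * ε * T then 1 else 0 := by
  set acc : List (Fin (n + 1)) → ℝ := fun xs => if Accurate q G ε T xs then 1 else 0 with hacc
  have h1 : 2 * sampleMean (triWeight n) T acc =
      sampleMean (triWeight n) T fun xs => acc xs + acc (flipSamples hn q xs) := by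
    rw [sampleMean_add, sampleMean_flipSamples]
    ring
  have h2 : (sampleMean (triWeight n) T fun xs => acc xs + acc (flipSamples hn q xs)) ≤
      sampleMean (triWeight n) T fun xs =>
        1 + if |((flipDiff hn q xs : ℤ) : ℝ)| ≤ 4 * ε * T then 1 else 0 := by
    refine sampleMean_mono triWeight_nonneg T fun xs => ?_
    by_cases ha : Accurate q G ε T xs
    · by_cases hb : Accurate q G ε T (flipSamples hn q xs)
      -- Both sample lists produce the same estimate, so their empirical CDFs differ by at most 2ε
      -- at each of the two smallest thresholds.
      · have : |((flipDiff hn q xs : ℤ) : ℝ)| ≤ 4 * ε * T := by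
          have a0 := ha ⟨0, by omega⟩
          have a1 := ha ⟨1, by omega⟩
          have b0 := hb ⟨0, by omega⟩
          have b1 := hb ⟨1, by omega⟩
          rw [transcript_flipSamples] at b0 b1
          have hT' : (0 : ℝ) < T := by positivity
          rw [flipDiff, Int.cast_sub, sum_level hn, sum_level hn]
          set s0 := thresholdSum xs ⟨0, by omega⟩
          set s1 := thresholdSum xs ⟨1, by omega⟩
          set u0 := thresholdSum (flipSamples hn q xs) ⟨0, by omega⟩
          set u1 := thresholdSum (flipSamples hn q xs) ⟨1, by omega⟩
          rw [← div_le_iff₀ hT', show |u0 + u1 - (s0 + s1)| / (T : ℝ) =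
              |(u0 + u1 - (s0 + s1)) / T| by rw [abs_div, abs_of_pos hT'],
            show (u0 + u1 - (s0 + s1)) / (T : ℝ) =
              1 / T * u0 + 1 / T * u1 - (1 / T * s0 + 1 / T * s1) by ring]
          rw [abs_le] at *
          constructor <;> linarith
        simp only [hacc, ha, hb, this, if_true, le_refl]
      · simp only [hacc, ha, hb, if_true, if_false, add_zero]
        exact le_add_of_nonneg_right (by positivity)
    · simp only [hacc, ha, if_false, zero_add]
      split_ifs <;> norm_num
  rw [← h1, sampleMean_add, sampleMean_const (sum_triWeight hn),
    sampleMean_flipDiff hn q T fun r => if |(r : ℝ)| ≤ 4 * ε * T then 1 else 0] at h2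
  linarith

theorem AccurateOnAverage.one_le_sq_mul {Ω : Type*} [MeasurableSpace Ω] {A : Algorithm n Ω}
    {P : Measure Ω} [IsProbabilityMeasure P] {ε : ℝ} {T : ℕ} (h : AccurateOnAverage A P ε T)
    (hn : 2 ≤ n) (hT : 0 < T) (hε : 0 < ε) : 1 ≤ 900 * ε ^ 2 * T := by
  classical
  by_contra! hlt
  obtain ⟨ω, hω⟩ := h.exists_seed (by omega) (fun _ : Unit => triWeight n)
    (fun _ => triWeight_nonneg) (fun _ => sum_triWeight hn)
  simp only [Fintype.card_unit, Nat.cast_one, one_mul, Finset.univ_unique, Finset.sum_const,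
    Finset.card_singleton, one_smul] at hω
  have h1 := hω.trans (sampleMean_accurate_le hn (A.query ω) (A.estimate ω) ε hT)
  have hs : 0 < √(T : ℝ) := Real.sqrt_pos.2 (by positivity)
  have hss : √(T : ℝ) * √T = T := Real.mul_self_sqrt (by positivity)
  -- The 900 in the statement is 30², and 30 = 4 / (2/15) matches the window 4εT with the one
  -- allowed for the walk.
  have h2 : 30 * (ε * √T) < 1 := by
    refine lt_of_pow_lt_pow_left₀ 2 zero_le_one ?_
    calc (30 * (ε * √(T : ℝ))) ^ 2 = 900 * ε ^ 2 * (√T * √T) := by ring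
      _ < 1 ^ 2 := by rw [hss, one_pow]; exact hlt
  have h3 : 4 * ε * T < 2 / 15 * √T := by
    calc 4 * ε * T = 2 / 15 * √T * (30 * (ε * √T)) := by
          linear_combination (-4 * ε) * hss
      _ < 2 / 15 * √T * 1 := by gcongr
      _ = _ := mul_one _
  have h4 := walkMean_abs_le_lt_half hT (by positivity) h3
  linarith

/-! ### A change of measure along the transcript -/

/-- The Gibbs variational inequality on two points, with relative entropy bounded by the χ²
divergence (a - b)²/(b(1 - b)); here b(1 - b) ≥ 3/16. -/
theorem bernoulli_gibbs {a b : ℝ} (ha : 1 / 4 ≤ a) (ha' : a ≤ 3 / 4) (hb : 1 / 4 ≤ b)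
    (hb' : b ≤ 3 / 4) (x y : ℝ) :
    a * x + (1 - a) * y ≤
      16 / 3 * (a - b) ^ 2 + Real.log (b * Real.exp x + (1 - b) * Real.exp y) := by
  have key : ∀ {a b z : ℝ} (x : ℝ), 0 < a → 0 < b → 0 < z →
      a * x ≤ a * Real.log z + (b * Real.exp x / z - a) + a * (a / b - 1) := by
    intro a b z x ha hb hz
    have h1 := Real.log_le_sub_one_of_pos
      (show 0 < b * Real.exp x / (a * z) by positivity)
    have h2 := Real.log_le_sub_one_of_pos (show 0 < a / b by positivity)
    rw [Real.log_div (by positivity) (by positivity), Real.log_mul hb.ne' (Real.exp_pos x).ne',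
      Real.log_mul ha.ne' hz.ne', Real.log_exp] at h1
    rw [Real.log_div ha.ne' hb.ne'] at h2
    have h3 : x ≤ Real.log z + (b * Real.exp x / (a * z) - 1) + (a / b - 1) := by linarith
    calc a * x ≤ a * (Real.log z + (b * Real.exp x / (a * z) - 1) + (a / b - 1)) :=
          mul_le_mul_of_nonneg_left h3 ha.le
      _ = _ := by field_simp
  have hb0 : 0 < b := by linarith
  have hb1 : 0 < 1 - b := by linarith
  set z := b * Real.exp x + (1 - b) * Real.exp y with hz
  have hz0 : 0 < z := by positivity
  have h1 := key x (by linarith : 0 < a) hb0 hz0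
  have h2 := key y (by linarith : 0 < 1 - a) hb1 hz0
  have h3 : b * Real.exp x / z + (1 - b) * Real.exp y / z = 1 := by
    rw [← add_div, ← hz, div_self hz0.ne']
  have h4 : a * (a / b - 1) + (1 - a) * ((1 - a) / (1 - b) - 1) =
      (a - b) ^ 2 / (b * (1 - b)) := by
    field_simp
    ring
  have h5 : (a - b) ^ 2 / (b * (1 - b)) ≤ 16 / 3 * (a - b) ^ 2 := by
    rw [div_le_iff₀ (by positivity)]
    nlinarith [mul_nonneg (sub_nonneg.2 hb) (sub_nonneg.2 hb'), sq_nonneg (a - b)]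
  linarith

/-- The cumulative distribution function of the weights `w`. -/
def weightCDF (w : Fin (n + 1) → ℝ) (i : Fin n) : ℝ := ∑ y, w y * (threshold y i : ℝ)

theorem sum_weights_answer {w : Fin (n + 1) → ℝ} (hw1 : ∑ y, w y = 1) (i : Fin n) (f : I → ℝ) :
    ∑ y, w y * f (threshold y i) = weightCDF w i * f 1 + (1 - weightCDF w i) * f 0 := by
  rw [← hw1, weightCDF, ← Finset.sum_sub_distrib, Finset.sum_mul, Finset.sum_mul,
    ← Finset.sum_add_distrib]
  refine Finset.sum_congr rfl fun y _ => ?_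
  change w y * f (if _ then 1 else 0) = w y * ((if _ then 1 else 0 : I) : ℝ) * f 1 +
    (w y - w y * ((if _ then 1 else 0 : I) : ℝ)) * f 0
  split_ifs <;> simp

open Classical in
/-- The number of queries in `B` recorded in a history. -/
def visits (B : Fin n → Prop) (h : History n) : ℝ := (h.map fun z => if B z.1 then 1 else 0).sum

open Classical in
theorem visits_cons (B : Fin n → Prop) (i : Fin n) (v : I) (h : History n) :
    visits B ((i, v) :: h) = (if B i then 1 else 0) + visits B h := by
  simp [visits]

open Classical in
-- The variational inequality for whole transcripts: by the chain rule the relative entropy adds up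
-- over the rounds, and only queries in `B` contribute.
theorem sampleMean_transcript_le {w w' : Fin (n + 1) → ℝ} (hw' : ∀ y, 0 ≤ w' y)
    (hw1 : ∑ y, w y = 1) (hw1' : ∑ y, w' y = 1)
    (hF : ∀ i, 1 / 4 ≤ weightCDF w i ∧ weightCDF w i ≤ 3 / 4)
    (hF' : ∀ i, 1 / 4 ≤ weightCDF w' i ∧ weightCDF w' i ≤ 3 / 4) {B : Fin n → Prop} {D : ℝ}
    (hD : ∀ i, 16 / 3 * (weightCDF w' i - weightCDF w i) ^ 2 ≤ D * if B i then 1 else 0)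
    (q : History n → Fin n) (T : ℕ) (f : History n → ℝ) :
    sampleMean w' T (fun xs => f (transcript q xs)) ≤
      D * sampleMean w' T (fun xs => visits B (transcript q xs)) +
        Real.log (sampleMean w T fun xs => Real.exp (f (transcript q xs))) := by
  induction T generalizing f with
  | zero => simp [sampleMean, transcript, visits]
  | succ T ih =>
    -- The last answer is integrated out under `w` inside the exponential; `g` is then the test
    -- function for the first T rounds.
    set g : History n → ℝ := fun h => Real.log
      (weightCDF w (q h) * Real.exp (f ((q h, 1) :: h)) +
        (1 - weightCDF w (q h)) * Real.exp (f ((q h, 0) :: h))) with hg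
    have hpos : ∀ h, 0 < weightCDF w (q h) * Real.exp (f ((q h, 1) :: h)) +
        (1 - weightCDF w (q h)) * Real.exp (f ((q h, 0) :: h)) := fun h =>
      add_pos (mul_pos (by linarith [(hF (q h)).1]) (Real.exp_pos _))
        (mul_pos (by linarith [(hF (q h)).2]) (Real.exp_pos _))
    have e1 : sampleMean w (T + 1) (fun xs => Real.exp (f (transcript q xs))) =
        sampleMean w T fun xs => Real.exp (g (transcript q xs)) := by
      simp only [sampleMean, transcript]
      congr 1
      funext xs
      rw [sum_weights_answer hw1 _ fun v => Real.exp (f ((_, v) :: _)), hg,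
        Real.exp_log (hpos _)]
    have e2 : sampleMean w' (T + 1) (fun xs => visits B (transcript q xs)) =
        sampleMean w' T (fun xs => if B (q (transcript q xs)) then 1 else 0) +
          sampleMean w' T fun xs => visits B (transcript q xs) := by
      rw [← sampleMean_add]
      simp only [sampleMean, transcript, visits_cons]
      congr 1
      funext xs
      rw [← Finset.sum_mul, hw1', one_mul]
    have e3 : sampleMean w' (T + 1) (fun xs => f (transcript q xs)) ≤
        D * sampleMean w' T (fun xs => if B (q (transcript q xs)) then 1 else 0) +
          sampleMean w' T fun xs => g (transcript q xs) := by
      rw [← sampleMean_const_mul, ← sampleMean_add]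
      simp only [sampleMean, transcript]
      refine sampleMean_mono hw' T fun xs => ?_
      rw [sum_weights_answer hw1' _ fun v => f ((_, v) :: _)]
      exact (bernoulli_gibbs (hF' _).1 (hF' _).2 (hF _).1 (hF _).2 _ _).trans
        (add_le_add_left (hD _) _)
    rw [e1, e2]
    linarith [ih g]

open Classical in
/-- An event of the transcript with mean `s'` under `w'` and `s` under `w` satisfies
`s' log N ≤ D · visits + N s`. -/
theorem sampleMean_event_mul_log_le {w w' : Fin (n + 1) → ℝ} (hw : ∀ y, 0 ≤ w y)
    (hw' : ∀ y, 0 ≤ w' y)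
    (hw1 : ∑ y, w y = 1) (hw1' : ∑ y, w' y = 1)
    (hF : ∀ i, 1 / 4 ≤ weightCDF w i ∧ weightCDF w i ≤ 3 / 4)
    (hF' : ∀ i, 1 / 4 ≤ weightCDF w' i ∧ weightCDF w' i ≤ 3 / 4) {B : Fin n → Prop} {D : ℝ}
    (hD : ∀ i, 16 / 3 * (weightCDF w' i - weightCDF w i) ^ 2 ≤ D * if B i then 1 else 0)
    (q : History n → Fin n) (T : ℕ) (E : History n → Prop) {N : ℝ} (hN : 1 ≤ N) :
    sampleMean w' T (fun xs => if E (transcript q xs) then 1 else 0) * Real.log N ≤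
      D * sampleMean w' T (fun xs => visits B (transcript q xs)) +
        N * sampleMean w T fun xs => if E (transcript q xs) then 1 else 0 := by
  -- The test function is log N on `E` and 0 elsewhere; its exponential is affine in the indicator,
  -- and log(1 + u) ≤ u finishes.
  have h := sampleMean_transcript_le hw' hw1 hw1' hF hF' hD q T
    fun h => Real.log N * if E h then 1 else 0
  rw [sampleMean_const_mul] at h
  have he : (fun xs => Real.exp (Real.log N * if E (transcript q xs) then 1 else 0)) =
      fun xs => 1 + (N - 1) * if E (transcript q xs) then 1 else 0 := by
    funext xs
    split_ifs
    · rw [mul_one, mul_one, Real.exp_log (by linarith)]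
      ring
    · simp
  rw [he, sampleMean_add, sampleMean_const hw1, sampleMean_const_mul] at h
  have hs : 0 ≤ sampleMean w T fun xs => if E (transcript q xs) then (1 : ℝ) else 0 :=
    (sampleMean_const hw1 T 0).symm.le.trans (sampleMean_mono hw T fun xs => by positivity)
  have hl := Real.log_le_sub_one_of_pos (by nlinarith :
    0 < 1 + (N - 1) * sampleMean w T fun xs => if E (transcript q xs) then (1 : ℝ) else 0)
  linarith

/-! ### Frequencies of a sample -/

section Occurrences

variable {α : Type*} [DecidableEq α]

/-- The number of occurrences of `s` in `xs`. -/
def occurrences (s : α) (xs : List α) : ℝ := (xs.map fun x => if x = s then 1 else 0).sum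

theorem occurrences_cons (s x : α) (xs : List α) :
    occurrences s (x :: xs) = (if x = s then 1 else 0) + occurrences s xs := by
  simp [occurrences]

theorem sampleMean_exp_neg_occurrences [Fintype α] {w : α → ℝ} (hw1 : ∑ y, w y = 1) (s : α) (T : ℕ) :
    sampleMean w T (fun xs => Real.exp (-occurrences s xs)) =
      (1 - w s * (1 - Real.exp (-1))) ^ T := by
  induction T with
  | zero => simp [sampleMean, occurrences]
  | succ T ih =>
    have h : ∑ y, w y * Real.exp (-if y = s then (1 : ℝ) else 0) =
        1 - w s * (1 - Real.exp (-1)) := by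
      have : ∀ y, w y * Real.exp (-if y = s then (1 : ℝ) else 0) =
          w y - if y = s then w s * (1 - Real.exp (-1)) else 0 := by
        intro y
        split_ifs with hy
        · rw [hy]
          ring
        · simp
      simp only [this, Finset.sum_sub_distrib, hw1, Finset.sum_ite_eq', Finset.mem_univ, if_true]
    simp only [sampleMean, occurrences_cons, neg_add, Real.exp_add, ← mul_assoc,
      ← Finset.sum_mul]
    rw [pow_succ', ← ih, ← sampleMean_const_mul]
    congr 1
    funext xs
    rw [← h]

/-- A sample of probability at least `p` seldom has fewer than `a` occurrences. -/
theorem sampleMean_occurrences_le [Fintype α] {w : α → ℝ} (hw : ∀ y, 0 ≤ w y) (hw1 : ∑ y, w y = 1) (s : α)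
    {p : ℝ} (hp : p ≤ w s) (T : ℕ) (a : ℝ) :
    sampleMean w T (fun xs => if occurrences s xs ≤ a then 1 else 0) ≤
      Real.exp (a - p / 2 * T) := by
  have h1 : sampleMean w T (fun xs => if occurrences s xs ≤ a then (1 : ℝ) else 0) ≤
      Real.exp a * sampleMean w T fun xs => Real.exp (-occurrences s xs) := by
    rw [← sampleMean_const_mul]
    refine sampleMean_mono hw T fun xs => ?_
    rw [← Real.exp_add]
    split_ifs with h
    · exact Real.one_le_exp (by linarith)
    · positivity
  refine h1.trans ?_
  rw [sampleMean_exp_neg_occurrences hw1, sub_eq_add_neg a, Real.exp_add]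
  refine mul_le_mul_of_nonneg_left ?_ (Real.exp_pos a).le
  have he : Real.exp (-1) ≤ 1 / 2 := by
    rw [Real.exp_neg, ← one_div]
    exact one_div_le_one_div_of_le (by norm_num) (by linarith [Real.add_one_le_exp (1 : ℝ)])
  have hs1 : w s ≤ 1 := by
    rw [← hw1]
    exact Finset.single_le_sum (fun y _ => hw y) (Finset.mem_univ s)
  have hb : 0 ≤ 1 - w s * (1 - Real.exp (-1)) := by
    nlinarith [Real.exp_pos (-1), hw s]
  have hb' : 1 - w s * (1 - Real.exp (-1)) ≤ Real.exp (-(p / 2)) := by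
    nlinarith [Real.add_one_le_exp (-(p / 2)), hw s]
  calc (1 - w s * (1 - Real.exp (-1))) ^ T ≤ Real.exp (-(p / 2)) ^ T := pow_le_pow_left₀ hb hb' T
    _ = _ := by
      rw [← Real.exp_nat_mul]
      ring_nf

end Occurrences

/-! ### Distributions with one hidden atom in every block -/

section Blocks

variable {k m : ℕ}

/-- The `r`-th position of the block `j`. -/
def mark (hkm : k * m < n) (j : Fin k) (r : Fin m) : Fin n :=
  ⟨j * m + r + 1, by
    have h1 : ((j : ℕ) + 1) * m ≤ k * m := Nat.mul_le_mul_right m j.2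
    have h2 := r.2
    rw [add_mul] at h1
    omega⟩

/-- The threshold just below the block `j`. -/
def anchor (hkm : k * m < n) (j : Fin k) : Fin n :=
  ⟨j * m, (Nat.mul_le_mul_right m j.2.le).trans_lt hkm⟩

/-- Atoms of mass `p` at the positions `θ j` of the blocks `j`; half of the remaining mass is at
the smallest sample and half at the largest. -/
def hiddenWeight (hkm : k * m < n) (p : ℝ) (θ : Fin k → Fin m) (y : Fin (n + 1)) : ℝ :=
  (1 - k * p) / 2 * (if y = 0 then 1 else 0) +
    (1 - k * p) / 2 * (if y = Fin.last n then 1 else 0) +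
    p * ∑ j, if y = (mark hkm j (θ j)).castSucc then 1 else 0

variable (hkm : k * m < n) {p : ℝ} (θ : Fin k → Fin m)

theorem hiddenWeight_nonneg (hp : 0 ≤ p) (hkp : k * p ≤ 1 / 2) (y : Fin (n + 1)) :
    0 ≤ hiddenWeight hkm p θ y := by
  have : 0 ≤ (1 - k * p) / 2 := by linarith
  rw [hiddenWeight]
  positivity

theorem sum_hiddenWeight_mul (f : Fin (n + 1) → ℝ) :
    ∑ y, hiddenWeight hkm p θ y * f y =
      (1 - k * p) / 2 * f 0 + (1 - k * p) / 2 * f (Fin.last n) +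
        p * ∑ j, f (mark hkm j (θ j)).castSucc := by
  simp only [hiddenWeight, add_mul, Finset.sum_add_distrib, mul_assoc, ← Finset.mul_sum,
    Finset.sum_mul]
  rw [Finset.sum_comm]
  simp only [ite_mul, one_mul, zero_mul, Finset.sum_ite_eq', Finset.mem_univ, if_true]

theorem sum_hiddenWeight : ∑ y, hiddenWeight hkm p θ y = 1 := by
  have := sum_hiddenWeight_mul hkm (p := p) θ fun _ => 1
  simp only [mul_one, Finset.sum_const, Finset.card_univ, Fintype.card_fin, nsmul_eq_mul] at this
  rw [this]
  ring

theorem le_hiddenWeight_mark (hp : 0 ≤ p) (hkp : k * p ≤ 1 / 2) (j : Fin k) :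
    p ≤ hiddenWeight hkm p θ (mark hkm j (θ j)).castSucc := by
  have h1 : (1 : ℝ) ≤ ∑ j', if (mark hkm j (θ j)).castSucc = (mark hkm j' (θ j')).castSucc
      then 1 else 0 := by
    refine le_trans ?_ (Finset.single_le_sum (fun j' _ => by positivity) (Finset.mem_univ j))
    rw [if_pos rfl]
  have h2 : 0 ≤ (1 - k * p) / 2 := by linarith
  have h3 := mul_le_mul_of_nonneg_left h1 hp
  rw [hiddenWeight]
  refine (by linarith : p ≤ 0 + 0 + _).trans (add_le_add_left (add_le_add ?_ ?_) _) <;> positivity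

theorem eq_of_hiddenWeight_ne_zero {y : Fin (n + 1)} (h : hiddenWeight hkm p θ y ≠ 0) :
    y = 0 ∨ y = Fin.last n ∨ ∃ j, y = (mark hkm j (θ j)).castSucc := by
  by_contra! hy
  apply h
  simp [hiddenWeight, hy.1, hy.2.1, hy.2.2]

theorem weightCDF_hiddenWeight (i : Fin n) :
    weightCDF (hiddenWeight hkm p θ) i =
      (1 - k * p) / 2 + p * ∑ j, if mark hkm j (θ j) ≤ i then 1 else 0 := by
  have hi := i.2
  rw [weightCDF, sum_hiddenWeight_mul]
  simp only [threshold_val, Fin.val_zero, Nat.zero_le, if_true, mul_one, Fin.val_last,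
    if_neg (not_le.2 hi), mul_zero, add_zero, Fin.val_castSucc, Fin.le_def]

/-- The two large end atoms keep every answer away from being deterministic, so the quadratic
entropy bound applies. -/
theorem weightCDF_hiddenWeight_mem (hp : 0 ≤ p) (hkp : k * p ≤ 1 / 2) (i : Fin n) :
    1 / 4 ≤ weightCDF (hiddenWeight hkm p θ) i ∧ weightCDF (hiddenWeight hkm p θ) i ≤ 3 / 4 := by
  rw [weightCDF_hiddenWeight]
  have h0 : (0 : ℝ) ≤ ∑ j, if mark hkm j (θ j) ≤ i then 1 else 0 := by positivity
  have h1 : (∑ j, if mark hkm j (θ j) ≤ i then (1 : ℝ) else 0) ≤ k := by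
    refine (Finset.sum_le_card_nsmul _ _ 1 fun j _ => ?_).trans (by simp)
    split_ifs <;> norm_num
  have h2 := mul_nonneg hp h0
  have h3 := mul_le_mul_of_nonneg_left h1 hp
  constructor <;> linarith

/-- The threshold `i` belongs to the block `j`. -/
def InBlock (m j : ℕ) (i : Fin n) : Prop := ((i : ℕ) - 1) / m = j

/-- A threshold outside the block lies below all its positions or above all of them. Truncated
subtraction puts the threshold of index 0 into block 0, which is harmless. -/
theorem mark_le_iff_of_not_inBlock {j : Fin k} {i : Fin n} (h : ¬ InBlock m j i) (r r' : Fin m) :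
    mark hkm j r ≤ i ↔ mark hkm j r' ≤ i := by
  have hm : 0 < m := r.pos
  have key : ∀ r : Fin m, mark hkm j r ≤ i ↔ (j : ℕ) < ((i : ℕ) - 1) / m := by
    intro r
    have hr := r.2
    rw [Fin.le_def, mark]
    constructor
    · intro h1
      refine lt_of_le_of_ne ?_ (Ne.symm h)
      rw [Nat.le_div_iff_mul_le hm]
      dsimp only at h1
      omega
    · intro h1
      have h2 := (Nat.le_div_iff_mul_le hm).1 (Nat.succ_le_of_lt h1)
      rw [Nat.succ_mul] at h2
      dsimp only
      omega
  rw [key, key]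

open Classical in
theorem sq_weightCDF_update_sub_le (j : Fin k) (b : Fin m) (i : Fin n) :
    16 / 3 * (weightCDF (hiddenWeight hkm p (Function.update θ j b)) i -
      weightCDF (hiddenWeight hkm p θ) i) ^ 2 ≤
      16 / 3 * p ^ 2 * if InBlock m j i then 1 else 0 := by
  have h1 : weightCDF (hiddenWeight hkm p (Function.update θ j b)) i -
      weightCDF (hiddenWeight hkm p θ) i = p * ((if mark hkm j b ≤ i then 1 else 0) -
        if mark hkm j (θ j) ≤ i then 1 else 0) := by
    rw [weightCDF_hiddenWeight, weightCDF_hiddenWeight, add_sub_add_left_eq_sub, ← mul_sub,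
      ← Finset.sum_sub_distrib, Finset.sum_eq_single j]
    · rw [Function.update_self]
    · intro j' _ hj'
      rw [Function.update_of_ne hj', sub_self]
    · simp
  rw [h1, mul_pow, ← mul_assoc]
  refine mul_le_mul_of_nonneg_left ?_ (by positivity)
  by_cases h : InBlock m j i
  · rw [if_pos h]
    split_ifs <;> norm_num
  · simp only [mark_le_iff_of_not_inBlock hkm h b (θ j), sub_self, if_neg h]
    norm_num

theorem sum_visits_inBlock_le (h : History n) :
    ∑ j : Fin k, visits (InBlock m j) h ≤ h.length := by
  classical
  induction h with
  | nil => simp [visits]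
  | cons z h ih =>
    obtain ⟨i, v⟩ := z
    simp only [visits_cons, Finset.sum_add_distrib]
    have : (∑ j : Fin k, if InBlock m j i then (1 : ℝ) else 0) ≤ 1 := by
      rw [Finset.sum_boole]
      norm_cast
      refine Finset.card_le_one.2 fun a ha b hb => Fin.ext ?_
      exact (Finset.mem_filter.1 ha).2.symm.trans (Finset.mem_filter.1 hb).2
    push_cast [List.length_cons]
    linarith

/-! ### Decoding the hidden atoms -/

/-- The estimate `g` jumps in every block `j` at the position `θ j`. -/
def Decodes (ε : ℝ) (g : Fin n → I) : Prop :=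
  ∀ j r, 2 * ε < (g (mark hkm j r) : ℝ) - g (anchor hkm j) ↔ θ j ≤ r

theorem Decodes.eq {hkm : k * m < n} {θ θ' : Fin k → Fin m} {ε : ℝ} {g : Fin n → I}
    (h : Decodes hkm θ ε g) (h' : Decodes hkm θ' ε g) : θ = θ' := by
  funext j
  exact le_antisymm ((h j _).1 ((h' j _).2 le_rfl)) ((h' j _).1 ((h j _).2 le_rfl))

theorem threshold_mark_sub_anchor_eq_zero {j : Fin k} {r : Fin m} (hr : r < θ j)
    {y : Fin (n + 1)} (hy : y = 0 ∨ y = Fin.last n ∨ ∃ j, y = (mark hkm j (θ j)).castSucc) :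
    (threshold y (mark hkm j r) : ℝ) - threshold y (anchor hkm j) = 0 := by
  rw [threshold_val, threshold_val, sub_eq_zero]
  have hr' : (r : ℕ) < θ j := hr
  have hj : ((j : ℕ) + 1) * m ≤ k * m := Nat.mul_le_mul_right m j.2
  have h0 := (θ j).2
  congr 1
  apply propext
  simp only [mark, anchor]
  rw [add_mul, one_mul] at hj
  rcases hy with rfl | rfl | ⟨j', rfl⟩
  · simp
  · simp only [Fin.val_last]
    omega
  · simp only [Fin.val_castSucc, mark]
    have h1 := (θ j').2
    rcases lt_trichotomy (j' : ℕ) j with h | h | h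
    · have := Nat.mul_le_mul_right m (Nat.succ_le_of_lt h)
      rw [Nat.succ_mul] at this
      omega
    · have hjj : j' = j := Fin.ext h
      rw [hjj]
      omega
    · have := Nat.mul_le_mul_right m (Nat.succ_le_of_lt h)
      rw [Nat.succ_mul] at this
      omega

theorem indicator_le_threshold_mark_sub_anchor {j : Fin k} {r : Fin m} (hr : θ j ≤ r)
    (y : Fin (n + 1)) :
    (if y = (mark hkm j (θ j)).castSucc then (1 : ℝ) else 0) ≤
      threshold y (mark hkm j r) - threshold y (anchor hkm j) := by
  rw [threshold_val, threshold_val]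
  have hr' : (θ j : ℕ) ≤ r := hr
  have hm : (mark hkm j r : ℕ) = j * m + r + 1 := rfl
  have hm' : (mark hkm j (θ j) : ℕ) = j * m + θ j + 1 := rfl
  have ha : (anchor hkm j : ℕ) = j * m := rfl
  by_cases h1 : y = (mark hkm j (θ j)).castSucc
  · have hy : (y : ℕ) = mark hkm j (θ j) := by rw [h1, Fin.val_castSucc]
    rw [if_pos h1, if_pos (by omega), if_neg (by omega)]
    norm_num
  · rw [if_neg h1]
    by_cases h2 : (y : ℕ) ≤ anchor hkm j
    · rw [if_pos h2, if_pos (by omega), sub_self]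
    · rw [if_neg h2, sub_zero]
      positivity

/-- From the anchor to a position of the block, the empirical CDF does not grow before the atom and
grows by more than 4ε from the atom on. The estimated increment errs by at most 2ε, so the cutoff 2ε
separates the cases. -/
theorem decodes_of_accurate {q : History n → Fin n} {G : History n → Fin n → I} {ε : ℝ} {T : ℕ}
    (hT : 0 < T) {xs : List (Fin (n + 1))} (hacc : Accurate q G ε T xs)
    (hs : ∀ y ∈ xs, hiddenWeight hkm p θ y ≠ 0)
    (ho : ∀ j, 4 * ε * T < occurrences (mark hkm j (θ j)).castSucc xs) :
    Decodes hkm θ ε (G (transcript q xs)) := by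
  classical
  intro j r
  have hT' : (0 : ℝ) < T := by positivity
  have h1 := abs_le.1 (hacc (mark hkm j r))
  have h2 := abs_le.1 (hacc (anchor hkm j))
  constructor
  · intro hlt
    by_contra! hr
    have h0 : thresholdSum xs (mark hkm j r) = thresholdSum xs (anchor hkm j) := by
      rw [thresholdSum, thresholdSum]
      congr 1
      refine List.map_congr_left fun y hy => sub_eq_zero.1 ?_
      exact threshold_mark_sub_anchor_eq_zero hkm θ hr
        (eq_of_hiddenWeight_ne_zero hkm θ (hs y hy))
    rw [h0] at h1
    linarith
  · intro hr
    have h3 : ∀ ys : List (Fin (n + 1)), occurrences (mark hkm j (θ j)).castSucc ys ≤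
        thresholdSum ys (mark hkm j r) - thresholdSum ys (anchor hkm j) := by
      intro ys
      induction ys with
      | nil => simp [occurrences, thresholdSum]
      | cons y ys ih =>
        rw [occurrences_cons, thresholdSum_cons, thresholdSum_cons]
        linarith [indicator_le_threshold_mark_sub_anchor hkm θ hr y]
    have h4 : 4 * ε < 1 / T * thresholdSum xs (mark hkm j r) -
        1 / T * thresholdSum xs (anchor hkm j) := by
      rw [← mul_sub, one_div_mul_eq_div, lt_div_iff₀ hT']
      exact (ho j).trans_le (h3 xs)
    linarith

open Classical in
theorem sampleMean_accurate_le_decodes (hp : 0 ≤ p) (hkp : k * p ≤ 1 / 2) (q : History n → Fin n)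
    (G : History n → Fin n → I) (ε : ℝ) {T : ℕ} (hT : 0 < T) :
    sampleMean (hiddenWeight hkm p θ) T (fun xs => if Accurate q G ε T xs then 1 else 0) ≤
      sampleMean (hiddenWeight hkm p θ) T
        (fun xs => if Decodes hkm θ ε (G (transcript q xs)) then 1 else 0) +
        k * Real.exp (4 * ε * T - p / 2 * T) := by
  have hw := hiddenWeight_nonneg hkm θ hp hkp
  have h1 : sampleMean (hiddenWeight hkm p θ) T
      (fun xs => if Accurate q G ε T xs then (1 : ℝ) else 0) ≤
      sampleMean (hiddenWeight hkm p θ) T fun xs =>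
        (if Decodes hkm θ ε (G (transcript q xs)) then 1 else 0) +
          ∑ j, if occurrences (mark hkm j (θ j)).castSucc xs ≤ 4 * ε * T then 1 else 0 := by
    refine sampleMean_mono_of_support hw T fun xs _ hs => ?_
    have hnn : (0 : ℝ) ≤
        ∑ j, if occurrences (mark hkm j (θ j)).castSucc xs ≤ 4 * ε * T then 1 else 0 := by
      positivity
    by_cases ha : Accurate q G ε T xs
    · by_cases ho : ∀ j, 4 * ε * T < occurrences (mark hkm j (θ j)).castSucc xs
      · rw [if_pos ha, if_pos (decodes_of_accurate hkm θ hT ha hs ho)]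
        linarith
      · push Not at ho
        obtain ⟨j, hj⟩ := ho
        have h2 : (1 : ℝ) ≤
            ∑ j, if occurrences (mark hkm j (θ j)).castSucc xs ≤ 4 * ε * T then 1 else 0 := by
          refine le_trans ?_
            (Finset.single_le_sum (fun j' _ => by positivity) (Finset.mem_univ j))
          rw [if_pos hj]
        rw [if_pos ha]
        exact h2.trans (le_add_of_nonneg_left (by positivity))
    · rw [if_neg ha]
      positivity
  refine h1.trans ?_
  rw [sampleMean_add, sampleMean_sum]
  refine add_le_add_right ?_ _
  refine (Finset.sum_le_card_nsmul _ _ _ fun j _ => sampleMean_occurrences_le hw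
    (sum_hiddenWeight hkm θ) _ (le_hiddenWeight_mark hkm θ hp hkp j) T _).trans ?_
  simp

/-! ### Averaging over the hidden atoms -/

/-- Exchanging the old and the new value of coordinate j is an involution, so each vector arises
from exactly m - 1 others. -/
theorem sum_update_ne (j : Fin k) (g : (Fin k → Fin m) → ℝ) :
    ∑ θ : Fin k → Fin m, ∑ b, (if b = θ j then 0 else g (Function.update θ j b)) =
      ((m : ℝ) - 1) * ∑ θ, g θ := by
  have hinv : Function.Involutive fun z : (Fin k → Fin m) × Fin m =>
      (Function.update z.1 j z.2, z.1 j) := by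
    rintro ⟨θ, b⟩
    simp
  rw [← Fintype.sum_prod_type' (f := fun (θ : Fin k → Fin m) b =>
      if b = θ j then (0 : ℝ) else g (Function.update θ j b)),
    ← Equiv.sum_comp hinv.toPerm, Fintype.sum_prod_type, Finset.mul_sum]
  refine Finset.sum_congr rfl fun θ _ => ?_
  have : ∀ b : Fin m, (if θ j = b then (0 : ℝ) else g θ) = g θ - if θ j = b then g θ else 0 := by
    intro b
    split_ifs <;> simp
  simp only [Function.Involutive.coe_toPerm, Function.update_self, Function.update_idem,
    Function.update_eq_self, this, Finset.sum_sub_distrib, Finset.sum_ite_eq, Finset.mem_univ,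
    if_true, Finset.sum_const, Finset.card_univ, Fintype.card_fin, nsmul_eq_mul]
  ring

open Classical in
-- An estimate decodes to at most one vector, and different proper changes of one coordinate give
-- different vectors.
theorem sum_decodes_update_le_one (ε : ℝ) (g : Fin n → I) :
    ∑ j, ∑ b, (if b = θ j then (0 : ℝ) else
      if Decodes hkm (Function.update θ j b) ε g then 1 else 0) ≤ 1 := by
  rw [← Fintype.sum_prod_type' (f := fun j b => if b = θ j then (0 : ℝ) else
      if Decodes hkm (Function.update θ j b) ε g then 1 else 0)]
  have : ∀ z : Fin k × Fin m, (if z.2 = θ z.1 then (0 : ℝ) else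
      if Decodes hkm (Function.update θ z.1 z.2) ε g then 1 else 0) =
      if z.2 ≠ θ z.1 ∧ Decodes hkm (Function.update θ z.1 z.2) ε g then 1 else 0 := by
    intro z
    by_cases h : z.2 = θ z.1 <;> simp [h]
  simp only [this]
  rw [Finset.sum_boole]
  norm_cast
  refine Finset.card_le_one.2 ?_
  rintro ⟨j, b⟩ h ⟨j', b'⟩ h'
  simp only [Finset.mem_filter, Finset.mem_univ, true_and] at h h'
  have he := h.2.eq h'.2
  have hj : j = j' := by
    by_contra hne
    have := congrFun he j
    rw [Function.update_self, Function.update_of_ne hne] at this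
    exact h.1 this
  subst hj
  have := congrFun he j
  rw [Function.update_self, Function.update_self] at this
  rw [this]

end Blocks

open Classical in
theorem decoding_bound {k m : ℕ} (hkm : k * m < n) {p : ℝ} (hp : 0 ≤ p) (hkp : k * p ≤ 1 / 2)
    (hk : 1 ≤ k) (hm : 2 ≤ m) (q : History n → Fin n) (G : History n → Fin n → I) (ε : ℝ) (T : ℕ)
    (hs : Fintype.card (Fin k → Fin m) * (1 / 2 : ℝ) ≤
      ∑ θ : Fin k → Fin m, sampleMean (hiddenWeight hkm p θ) T
        fun xs => if Decodes hkm θ ε (G (transcript q xs)) then 1 else 0) :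
    k * (1 / 2 * Real.log (k * (m - 1)) - 1) ≤ 16 / 3 * p ^ 2 * T := by
  set N : ℝ := k * (m - 1) with hN
  set M : ℝ := ((Fintype.card (Fin k → Fin m) : ℕ) : ℝ) with hM
  set D : ℝ := 16 / 3 * p ^ 2 with hD
  set w := hiddenWeight hkm p with hw
  set s : (Fin k → Fin m) → (Fin k → Fin m) → ℝ := fun θ' θ =>
    sampleMean (w θ') T fun xs => if Decodes hkm θ ε (G (transcript q xs)) then 1 else 0 with hsdef
  set V : Fin k → (Fin k → Fin m) → ℝ := fun j θ =>
    sampleMean (w θ) T fun xs => visits (InBlock m j) (transcript q xs) with hV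
  have hw0 : ∀ θ y, 0 ≤ w θ y := fun θ => hiddenWeight_nonneg hkm θ hp hkp
  have hw1 : ∀ θ, ∑ y, w θ y = 1 := fun θ => sum_hiddenWeight hkm θ
  have hm1 : (1 : ℝ) ≤ (m : ℝ) - 1 := by
    have : (2 : ℝ) ≤ m := by exact_mod_cast hm
    linarith
  have hk1 : (1 : ℝ) ≤ k := by exact_mod_cast hk
  have hN1 : 1 ≤ N := one_le_mul_of_one_le_of_one_le hk1 hm1
  have hM0 : 0 < M := by
    have : Nonempty (Fin k → Fin m) := ⟨fun _ => ⟨0, by omega⟩⟩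
    rw [hM]
    exact_mod_cast Fintype.card_pos
  -- The visits are counted under the modified vector, so that summing over θ and b turns them back
  -- into an average over all vectors.
  have pair : ∀ θ j b, (if b = θ j then (0 : ℝ) else
        s (Function.update θ j b) (Function.update θ j b) * Real.log N) ≤
      D * (if b = θ j then (0 : ℝ) else V j (Function.update θ j b)) +
        N * (if b = θ j then (0 : ℝ) else s θ (Function.update θ j b)) := by
    intro θ j b
    split_ifs with hb
    · simp
    · exact sampleMean_event_mul_log_le (hw0 θ) (hw0 _) (hw1 θ) (hw1 _)
        (weightCDF_hiddenWeight_mem hkm θ hp hkp) (weightCDF_hiddenWeight_mem hkm _ hp hkp)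
        (sq_weightCDF_update_sub_le hkm θ j b) q T
        (fun h => Decodes hkm (Function.update θ j b) ε (G h)) hN1
  have hV1 : ∀ θ, ∑ j, V j θ ≤ T := by
    intro θ
    rw [hV]
    dsimp only
    rw [← sampleMean_sum]
    refine (sampleMean_mono_of_support (hw0 θ) T fun xs hxs _ => ?_).trans
      (sampleMean_const (hw1 θ) T T).le
    refine (sum_visits_inBlock_le (transcript q xs)).trans ?_
    rw [length_transcript, hxs]
  have hs1 : ∀ θ, ∑ j, ∑ b, (if b = θ j then (0 : ℝ) else s θ (Function.update θ j b)) ≤ 1 := by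
    intro θ
    have h1 : ∀ j b, (if b = θ j then (0 : ℝ) else s θ (Function.update θ j b)) =
        sampleMean (w θ) T fun xs => if b = θ j then (0 : ℝ) else
          if Decodes hkm (Function.update θ j b) ε (G (transcript q xs)) then 1 else 0 := by
      intro j b
      split_ifs
      · exact (sampleMean_const (hw1 θ) T 0).symm
      · rfl
    simp only [h1, ← sampleMean_sum]
    exact (sampleMean_mono (hw0 θ) T fun xs => sum_decodes_update_le_one hkm θ ε _).trans
      (sampleMean_const (hw1 θ) T 1).le
  have total : ∑ j, ∑ θ : Fin k → Fin m, ∑ b, (if b = θ j then (0 : ℝ) else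
        s (Function.update θ j b) (Function.update θ j b) * Real.log N) ≤
      D * ∑ j, ∑ θ : Fin k → Fin m, ∑ b, (if b = θ j then (0 : ℝ) else
        V j (Function.update θ j b)) +
      N * ∑ θ : Fin k → Fin m, ∑ j, ∑ b, (if b = θ j then (0 : ℝ) else
        s θ (Function.update θ j b)) := by
    rw [Finset.sum_comm (s := (Finset.univ : Finset (Fin k → Fin m)))]
    simp only [Finset.mul_sum, ← Finset.sum_add_distrib]
    exact Finset.sum_le_sum fun j _ => Finset.sum_le_sum fun θ _ => Finset.sum_le_sum fun b _ =>
      pair θ j b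
  have t1 : ∑ j, ∑ θ : Fin k → Fin m, ∑ b, (if b = θ j then (0 : ℝ) else
        s (Function.update θ j b) (Function.update θ j b) * Real.log N) =
      N * (Real.log N * ∑ θ, s θ θ) := by
    simp only [fun j => sum_update_ne j fun θ : Fin k → Fin m => s θ θ * Real.log N]
    rw [Finset.sum_const, Finset.card_univ, Fintype.card_fin, nsmul_eq_mul, ← Finset.sum_mul]
    ring
  have t2 : ∑ j, ∑ θ : Fin k → Fin m, ∑ b, (if b = θ j then (0 : ℝ) else
        V j (Function.update θ j b)) ≤ ((m : ℝ) - 1) * (M * T) := by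
    simp only [fun j => sum_update_ne j (V j)]
    rw [← Finset.mul_sum, Finset.sum_comm]
    refine mul_le_mul_of_nonneg_left ?_ (by linarith)
    refine (Finset.sum_le_card_nsmul _ _ _ fun θ _ => hV1 θ).trans (le_of_eq ?_)
    rw [nsmul_eq_mul, Finset.card_univ]
  have t3 : ∑ θ : Fin k → Fin m, ∑ j, ∑ b, (if b = θ j then (0 : ℝ) else
        s θ (Function.update θ j b)) ≤ M := by
    refine (Finset.sum_le_card_nsmul _ _ _ fun θ _ => hs1 θ).trans (le_of_eq ?_)
    rw [nsmul_eq_mul, Finset.card_univ, mul_one]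
  have hlog : 0 ≤ Real.log N := Real.log_nonneg hN1
  have hD0 : 0 ≤ D := by positivity
  have h5 : N * (Real.log N * (M * (1 / 2))) ≤ D * (((m : ℝ) - 1) * (M * T)) + N * M := by
    calc N * (Real.log N * (M * (1 / 2))) ≤ N * (Real.log N * ∑ θ, s θ θ) := by gcongr
      _ ≤ _ := t1 ▸ total
      _ ≤ _ := by gcongr
  -- The common factor (m - 1)M is split off, using N = k(m - 1).
  have h6 : (((m : ℝ) - 1) * M) * (k * (1 / 2 * Real.log N - 1)) ≤
      (((m : ℝ) - 1) * M) * (D * T) := by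
    rw [hN] at h5 ⊢
    linarith
  exact le_of_mul_le_mul_left h6 (by positivity)

/-! ### The lower bound -/

section LowerBound

variable {Ω : Type*} [MeasurableSpace Ω] {A : Algorithm n Ω} {P : Measure Ω}
  [IsProbabilityMeasure P] {ε : ℝ} {T : ℕ}

theorem AccurateOnAverage.block_bound (h : AccurateOnAverage A P ε T) (hT : 0 < T) (hε : 0 < ε)
    {k m : ℕ} (hkm : k * m < n) (hk : 1 ≤ k) (hm : 2 ≤ m) (hkε : 200 * (k * ε) ≤ 1) :
    k * (1 / 2 * Real.log (k * (m - 1)) - 1) ≤ 16 / 3 * (100 * ε) ^ 2 * T := by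
  classical
  have hn : 2 ≤ n := by nlinarith
  have hkp : k * (100 * ε) ≤ 1 / 2 := by linarith
  have hp : 0 ≤ 100 * ε := by positivity
  obtain ⟨ω, hω⟩ := h.exists_seed (by omega) (fun θ : Fin k → Fin m => hiddenWeight hkm (100 * ε) θ)
    (fun θ => hiddenWeight_nonneg hkm θ hp hkp) (fun θ => sum_hiddenWeight hkm θ)
  refine decoding_bound hkm hp hkp hk hm (A.query ω) (A.estimate ω) ε T ?_
  have h1 := hω.trans (Finset.sum_le_sum fun θ _ =>
    sampleMean_accurate_le_decodes hkm θ hp hkp (A.query ω) (A.estimate ω) ε hT)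
  rw [Finset.sum_add_distrib, Finset.sum_const, Finset.card_univ, nsmul_eq_mul] at h1
  have hT' : (0 : ℝ) < T := by positivity
  have hsq := h.one_le_sq_mul hn hT hε
  -- The probability that some atom is too rare. By exp(-x) ≤ 1/x it is at most kε/(46 ε²T), which
  -- is small because kε ≤ 1/200 and ε²T ≥ 1/900. The success probability drops from 3/4 to 1/2.
  have h2 : k * Real.exp (4 * ε * T - 100 * ε / 2 * T) ≤ 1 / 4 := by
    have hx : 0 < 46 * ε * T := by positivity
    have h3 : Real.exp (4 * ε * T - 100 * ε / 2 * T) ≤ 1 / (46 * ε * T) := by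
      rw [show 4 * ε * T - 100 * ε / 2 * T = -(46 * ε * T) by ring, Real.exp_neg, ← one_div]
      exact one_div_le_one_div_of_le hx (by linarith [Real.add_one_le_exp (46 * ε * T)])
    refine (mul_le_mul_of_nonneg_left h3 (Nat.cast_nonneg k)).trans ?_
    rw [mul_one_div, div_le_iff₀ hx]
    refine le_of_mul_le_mul_right ?_ hε
    nlinarith
  have h4 := mul_le_mul_of_nonneg_left h2 (Nat.cast_nonneg (Fintype.card (Fin k → Fin m)) (α := ℝ))
  linarith

theorem half_log_le {n T : ℕ} (hn : 1 < n) (h : ((n : ℝ) + 1) * (3 / 4) ≤ 2 ^ T) :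
    1 / 2 * Real.log n ≤ T := by
  have hn0 : (0 : ℝ) < n := by positivity
  have h1 : Real.log ((n : ℝ)) ≤ Real.log ((2 ^ T) ^ 2) := by
    refine Real.log_le_log hn0 ?_
    have hn1 : (1 : ℝ) < n := by exact_mod_cast hn
    -- Squaring absorbs the factor 3/4: the square of 3(n + 1)/4 is at least n.
    nlinarith
  rw [← pow_mul, Real.log_pow] at h1
  push_cast at h1
  have h2 : Real.log 2 ≤ 1 := by linarith [Real.log_two_lt_d9]
  nlinarith [(Nat.cast_nonneg T : (0 : ℝ) ≤ T)]

theorem AccurateOnAverage.lower_bound_of_large (h : AccurateOnAverage A P ε T) (hT : 0 < T)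
    (hε : 0 < ε) (hε' : ε < 1 / 400) (hn : 1024 ≤ n) :
    min (n : ℝ) (1 / ε) * Real.log n ≤ 100000000 * (ε ^ 2 * T) := by
  set x : ℝ := 1 / (200 * ε) with hx
  have hx2 : 2 ≤ x := by
    rw [hx, le_div_iff₀ (by positivity)]
    linarith
  set k := min ((n - 1) / 2) ⌊x⌋₊ with hk
  set m := (n - 1) / k with hm
  have hfl : 2 ≤ ⌊x⌋₊ := Nat.le_floor (by exact_mod_cast hx2)
  have hk1 : 1 ≤ k := le_min (by omega) (by omega)
  have hk2 : 2 * k ≤ n - 1 := by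
    have := min_le_left ((n - 1) / 2) ⌊x⌋₊
    omega
  have hm2 : 2 ≤ m := (Nat.le_div_iff_mul_le hk1).2 hk2
  have hkm : k * m < n := by
    have := Nat.mul_div_le (n - 1) k
    rw [← hm] at this
    omega
  have hkm' : n ≤ k * m + k := by
    have := Nat.lt_mul_div_succ (n - 1) hk1
    rw [← hm, Nat.mul_succ] at this
    omega
  have hkε : 200 * (k * ε) ≤ 1 := by
    have h1 : (k : ℝ) ≤ x := (Nat.cast_le.2 (min_le_right _ _)).trans (Nat.floor_le (by linarith))
    rw [hx, le_div_iff₀ (by positivity)] at h1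
    linarith
  have hb := h.block_bound hT hε hkm hk1 hm2 hkε
  have hnR : (1024 : ℝ) ≤ n := by exact_mod_cast hn
  have hN : (n : ℝ) / 4 ≤ k * (m - 1) := by
    have h1 : (n : ℝ) ≤ k * m + k := by exact_mod_cast hkm'
    have h2 : (2 : ℝ) ≤ m := by exact_mod_cast hm2
    have h3 : (0 : ℝ) ≤ k := by positivity
    nlinarith
  have hlog4 : Real.log 4 = 2 * Real.log 2 := by
    rw [show (4 : ℝ) = 2 ^ 2 by norm_num, Real.log_pow]
    norm_num
  have hlogn : 10 * Real.log 2 ≤ Real.log n := by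
    have := Real.log_le_log (by norm_num) hnR
    rw [show (1024 : ℝ) = 2 ^ 10 by norm_num, Real.log_pow] at this
    exact_mod_cast this
  have hlogN : Real.log n - 2 * Real.log 2 ≤ Real.log (k * (m - 1)) := by
    rw [← hlog4, ← Real.log_div (by positivity) (by norm_num)]
    exact Real.log_le_log (by positivity) hN
  have hl2 := Real.log_two_gt_d9
  -- This amounts to log n ≥ 4 + 4 log 2, which n ≥ 1024 provides.
  have hq : 1 / 4 * Real.log n ≤ 1 / 2 * Real.log (k * (m - 1)) - 1 := by linarith
  have hmin : min (n : ℝ) (1 / ε) ≤ 400 * k := by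
    rcases min_choice ((n - 1) / 2) ⌊x⌋₊ with hc | hc
    · refine (min_le_left _ _).trans ?_
      have : n ≤ 400 * k := by omega
      exact_mod_cast this
    · refine (min_le_right _ _).trans ?_
      have h1 := Nat.lt_floor_add_one x
      rw [hk, hc]
      have h2 : 1 / ε = 200 * x := by
        rw [hx]
        field_simp
      have h3 : (1 : ℝ) ≤ ⌊x⌋₊ := by exact_mod_cast (by omega : 1 ≤ ⌊x⌋₊)
      rw [h2]
      linarith
  have hlog0 : 0 ≤ Real.log n := by linarith
  have hk0 : (0 : ℝ) ≤ k := by positivity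
  have h1 := mul_le_mul_of_nonneg_right hmin hlog0
  have h2 := mul_le_mul_of_nonneg_left hq hk0
  have h3 : 0 ≤ ε ^ 2 * T := by positivity
  nlinarith

theorem AccurateOnAverage.lower_bound (h : AccurateOnAverage A P ε T) (hn : 1 < n) (hT : 0 < T)
    (hε : 0 < ε) (hε' : ε < 1 / 2) :
    1 / 1000000000 * (min (n : ℝ) (1 / ε) * Real.log n / ε ^ 2) ≤ T := by
  have hn1 : (1 : ℝ) < n := by exact_mod_cast hn
  have hlog0 : 0 ≤ Real.log n := Real.log_nonneg hn1.le
  have hT' : (0 : ℝ) < T := by positivity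
  suffices hmain : min (n : ℝ) (1 / ε) * Real.log n ≤ 1000000000 * (ε ^ 2 * T) by
    rw [one_div_mul_eq_div, div_div, div_le_iff₀ (by positivity)]
    linarith
  have h3 : 0 ≤ ε ^ 2 * T := by positivity
  -- Hidden atoms serve small ε and large n, the three-sample bound small ε and n < 1024, and point
  -- masses ε ≥ 1/400. The constant 10⁹ is dictated by 900 · 1024² in the second case.
  rcases lt_or_ge ε (1 / 400) with hs | hs
  · rcases le_or_gt 1024 n with hl | hl
    · linarith [h.lower_bound_of_large hT hε hs hl]
    · have h1 := h.one_le_sq_mul hn hT hε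
      have h2 : min (n : ℝ) (1 / ε) ≤ 1024 :=
        (min_le_left _ _).trans (by exact_mod_cast hl.le)
      have h4 : Real.log n ≤ 1024 :=
        (Real.log_le_self (by positivity)).trans (by exact_mod_cast hl.le)
      calc min (n : ℝ) (1 / ε) * Real.log n ≤ 1024 * 1024 :=
            mul_le_mul h2 h4 hlog0 (by norm_num)
        _ ≤ 1000000000 * (ε ^ 2 * T) := by linarith
  · have h1 := half_log_le hn (h.le_two_pow (by omega) hT hε')
    have h2 : min (n : ℝ) (1 / ε) ≤ 400 := by
      refine (min_le_right _ _).trans ?_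
      rw [div_le_iff₀ hε]
      linarith
    have h4 : (1 / 400 : ℝ) ^ 2 ≤ ε ^ 2 := pow_le_pow_left₀ (by norm_num) hs 2
    calc min (n : ℝ) (1 / ε) * Real.log n ≤ 400 * (2 * T) :=
          mul_le_mul h2 (by linarith) hlog0 (by norm_num)
      _ ≤ 1000000000 * ((1 / 400) ^ 2 * T) := by
        norm_num
        linarith
      _ ≤ 1000000000 * (ε ^ 2 * T) := by gcongr

end LowerBound

end TQM

end

theorem mainTheorem2 :
    ∃ c : ℝ, 0 < c ∧
      ∀ (n : ℕ) (ε : ℝ) (T : ℕ), 1 < n → 0 < ε → ε < 1 / 2 → 0 < T →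
        ∀ (Ω : Type*) [MeasurableSpace Ω] (P : Measure Ω) [IsProbabilityMeasure P]
          (A : TQM.Algorithm n Ω),
          (TQM.SolvesTQM A P ε T →
            c * (min (n : ℝ) (1 / ε) * Real.log n / ε ^ 2) ≤ (T : ℝ)) ∧
          (TQM.SolvesCDF A P ε T →
            c * (min (n : ℝ) (1 / ε) * Real.log n / ε ^ 2) ≤ (T : ℝ)) ∧
          (TQM.SolvesIID A P ε T →
            c * (min (n : ℝ) (1 / ε) * Real.log n / ε ^ 2) ≤ (T : ℝ)) := by
  refine ⟨1 / 1000000000, by norm_num, ?_⟩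
  intro n ε T hn hε hε' hT Ω _ P _ A
  exact ⟨fun h => h.solvesCDF.accurateOnAverage.lower_bound hn hT hε hε',
    fun h => h.accurateOnAverage.lower_bound hn hT hε hε',
    fun h => h.accurateOnAverage.lower_bound hn hT hε hε'⟩
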